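/- Let $C$ be a field of characteristic zero, $K=C(t)$, and $\bar K$ an algebraic closure of $K$. Let $m\in K[x][y]$ be absolutely irreducible (irreducible over $\bar K$) with $n=\deg_y m>0$, and let $A=K(x)[y]/\langle m\rangle$. Write $f'=\partial_x f$ for the derivation of $A$ that vanishes on $K$ and satisfies $x'=1$, and $\partial_t$ for the derivation of $A$ with $\partial_t t=1$, $\partial_t x=0$, $\partial_t|_C=0$. An element $f\in A$ is *integrable* in $A$ if $f=G'$ for some $G\in A$. A *telescoper* for $f$ is a nonzero operator $P=\sum_{i=0}^{s}p_i\partial_t^i$ with $p_i\in K$ such that $P\cdot f$ is integrable in $A$; its order is the largest $i$ with $p_i\ne 0$. For $a\in\bar K\cup\{\infty\}$ put $z=x-a$ if $a\in\bar K$ and $z=x^{-1}$ if $a=\infty$. The series associated to $f\in A$ at $a$ are the images of $f$ under the ring homomorphisms from $A$ to the field $\bigcup_{r\ge1}\bar K((z^{1/r}))$ of Puiseux series that are the natural embedding on $K$ and send $x$ to its expansion at $a$. The element $f$ is *integral at $a$* if all these series contain only terms $z^\alpha$ with $\alpha\ge 0$; it has a *double root at infinity* if all its series at $\infty$ contain only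 terms $(1/x)^\alpha$ with $\alpha\ge 2$. An *integral basis* of $A$ is a family $W=(\omega_1,\dots,\omega_n)$ that is a basis of the $K[x]$-module of all elements that are integral at every $a\in\bar K$. It is *normal at infinity* if there are $r_1,\dots,r_n\in K(x)$ such that $r_1\omega_1,\dots,r_n\omega_n$ is a basis of the module of all elements that are integral at infinity, over the ring of rational functions $p/q\in K(x)$ with $\deg p\le\deg q$. *Hermite reduction* of $f\in A$ with respect to an integral basis $W$: let $e\in K[x]$ and $(m_{i,j})\in K[x]^{n\times n}$ be such that $e\,\omega_i'=\sum_j m_{i,j}\omega_j$ for all $i$, and $e$ and all the $m_{i,j}$ have no common nonconstant factor. Write $f=\sum_i (f_i/D)\,\omega_i$ with $f_i,D\in K[x]$, $D\neq0$, $e\mid D$. As long as $D$ is not squarefree, choose a factorization $D=uv^\mu$ with $\mu>1$, $v$ nonconstant and squarefree, $\gcd(u,v)=1$, find $g_i,h_i\in K[x]$ with $\deg g_i<\deg v$ and $$\sum_i\frac{f_i}{uv^\mu}\omega_i=\Bigl(\sum_i\frac{g_i}{v^{\mu-1}}\omega_i\Bigr)'+\sum_i\frac{h_i}{uv^{\mu-1}}\omega_i,$$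 and continue with $\sum_i \frac{h_i}{uv^{\mu-1}}\omega_i$. The output is $f=g'+h$, where $g$ is the sum of all the elements $\sum_i\frac{g_i}{v^{\mu-1}}\omega_i$ that occur and $h$ is the last remainder. **Theorem.** Let $W$ be an integral basis of $A$ that is normal at infinity, and let $f\in A$ have a double root at infinity. 1. If $f=g'+h$ is an output of the Hermite reduction with respect to $W$, then $h=0$ if and only if $f$ is integrable in $A$. 2. Each of $f,\partial_t f,\partial_t^2f,\dots$ has an output of the Hermite reduction with respect to $W$. Let $h_i$ be the remainder of such an output for $\partial_t^i f$ $(i=0,1,2,\dots)$. Then there is an $r\ge0$ such that $h_0,\dots,h_{r-1}$ are linearly independent over $K$ and $h_0,\dots,h_r$ are linearly dependent over $K$. For this $r$ and for every $(p_0,\dots,p_r)\in K^{r+1}\setminus\{0\}$ with $\sum_{i=0}^r p_ih_i=0$, the operator $P=\sum_{i=0}^r p_i\partial_t^i$ is a telescoper for $f$ of order exactly $r$, and every telescoper for $f$ has order at least $r$. -/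

import Mathlib

open Polynomial

noncomputable section

namespace AlgTelescoping

/-! ### Derivations of rational function fields and of their finite extensions -/

section Derivations

variable {K : Type*} [Field K]

/-- A map with the sum rule and the product rule, as a differential structure on a field. -/
@[reducible] def mkDifferential {F : Type*} [Field F] (D : F → F)
    (hadd : ∀ f g, D (f + g) = D f + D g) (hmul : ∀ f g, D (f * g) = f * D g + g * D f) :
    Differential F where
  deriv := Derivation.mk' (AddMonoidHom.toIntLinearMap (AddMonoidHom.mk' D hadd)) hmul

theorem differential_mul {R : Type*} [CommRing R] (d : Differential R) (f g : R) :
    d.deriv (f * g) = f * d.deriv g + g * d.deriv f :=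
  d.deriv.leibniz f g

/-- The quotient rule: the value on `f ∈ K(x)` of the extension to `K(x)` of a derivation `d`
of `K[x]`. -/
def quotientRule (d : Derivation ℤ K[X] K[X]) (f : RatFunc K) : RatFunc K :=
  (algebraMap K[X] (RatFunc K) (d f.num * f.denom - f.num * d f.denom)) /
    (algebraMap K[X] (RatFunc K) f.denom) ^ 2

theorem quotientRule_div (d : Derivation ℤ K[X] K[X]) (p q : K[X]) (hq : q ≠ 0) :
    quotientRule d (algebraMap K[X] (RatFunc K) p / algebraMap K[X] (RatFunc K) q) =
      (algebraMap K[X] (RatFunc K) (d p * q - p * d q)) / (algebraMap K[X] (RatFunc K) q) ^ 2 := by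
  set f := algebraMap K[X] (RatFunc K) p / algebraMap K[X] (RatFunc K) q with hf
  have hinj := RatFunc.algebraMap_injective K
  have hd : f.denom ≠ 0 := f.denom_ne_zero
  have hq' : algebraMap K[X] (RatFunc K) q ≠ 0 := by
    simpa using (map_ne_zero_iff _ hinj).2 hq
  have hd' : algebraMap K[X] (RatFunc K) f.denom ≠ 0 := (map_ne_zero_iff _ hinj).2 hd
  have h1 : f.num * q = p * f.denom := by
    apply hinj
    have := f.num_div_denom
    rw [hf, div_eq_div_iff hd' hq'] at this
    simpa [hf] using this
  have h2 : f.num * d q + q * d f.num = p * d f.denom + f.denom * d p := by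
    simpa using congrArg d h1
  rw [quotientRule, div_eq_div_iff (pow_ne_zero _ hd') (pow_ne_zero _ hq'), ← map_pow, ← map_pow,
    ← map_mul, ← map_mul]
  congr 1
  have h3 : (d f.num * f.denom - f.num * d f.denom) * q ^ 2 =
      (d p * q - p * d q) * f.denom ^ 2 +
        (f.num * d q + q * d f.num - (p * d f.denom + f.denom * d p)) * (f.denom * q) +
        (p * f.denom - f.num * q) * (q * d f.denom + f.denom * d q) := by ring
  rw [h3, h2, h1]
  ring

/-- The unique extension to `K(x)` of a derivation of `K[x]`. -/
@[reducible] def ratFuncDifferential (d : Derivation ℤ K[X] K[X]) : Differential (RatFunc K) :=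
  mkDifferential (quotientRule d)
    (by
      intro f g
      have hf := (map_ne_zero_iff _ (RatFunc.algebraMap_injective K)).2 f.denom_ne_zero
      have hg := (map_ne_zero_iff _ (RatFunc.algebraMap_injective K)).2 g.denom_ne_zero
      have h : f + g = algebraMap K[X] (RatFunc K) (f.num * g.denom + f.denom * g.num) /
          algebraMap K[X] (RatFunc K) (f.denom * g.denom) := by
        conv_lhs => rw [← f.num_div_denom, ← g.num_div_denom]
        rw [div_add_div _ _ hf hg]
        simp
      rw [h, quotientRule_div _ _ _ (mul_ne_zero f.denom_ne_zero g.denom_ne_zero)]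
      simp only [quotientRule, map_add, map_sub, map_mul, Derivation.leibniz, smul_eq_mul]
      field_simp
      ring)
    (by
      intro f g
      have hf := (map_ne_zero_iff _ (RatFunc.algebraMap_injective K)).2 f.denom_ne_zero
      have hg := (map_ne_zero_iff _ (RatFunc.algebraMap_injective K)).2 g.denom_ne_zero
      have h : f * g = algebraMap K[X] (RatFunc K) (f.num * g.num) /
          algebraMap K[X] (RatFunc K) (f.denom * g.denom) := by
        conv_lhs => rw [← f.num_div_denom, ← g.num_div_denom]
        rw [div_mul_div_comm]
        simp
      change quotientRule d (f * g) = f * quotientRule d g + g * quotientRule d f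
      rw [h, quotientRule_div _ _ _ (mul_ne_zero f.denom_ne_zero g.denom_ne_zero)]
      conv_rhs => rw [← f.num_div_denom, ← g.num_div_denom]
      rw [quotientRule_div _ _ _ f.denom_ne_zero, quotientRule_div _ _ _ g.denom_ne_zero]
      simp only [map_add, map_sub, map_mul, Derivation.leibniz, smul_eq_mul]
      field_simp
      ring)

theorem ratFuncDifferential_algebraMap (d : Derivation ℤ K[X] K[X]) (p : K[X]) :
    (ratFuncDifferential d).deriv (algebraMap K[X] (RatFunc K) p) =
      algebraMap K[X] (RatFunc K) (d p) := by
  change quotientRule d _ = _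
  have := quotientRule_div d p 1 one_ne_zero
  simpa using this

/-- The derivation `d/dx` of a rational function field `K(x)` with respect to its variable. -/
@[reducible] def differentialVar (K : Type*) [Field K] : Differential (RatFunc K) :=
  ratFuncDifferential (Polynomial.derivative'.restrictScalars ℤ)

/-- The derivation of `K(x)` that extends the derivation `δ` of `K` and sends `x` to `0`. -/
@[reducible] def differentialCoeff (δ : Differential K) : Differential (RatFunc K) :=
  ratFuncDifferential (@Differential.mapCoeffs K _ δ)

section AdjoinRootDerivation

set_option linter.unusedSectionVars false

variable {F : Type*} [Field F] [CharZero F] (d : Differential F) (M : F[X])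
  [Fact (Irreducible M)]

/-- The derivative of `y` in `F[y]/⟨M⟩`, obtained by differentiating `M(y) = 0`: it is
`-(M^d)(y) / (∂M/∂y)(y)`, where `M^d` arises from `M` by applying `d` to the coefficients. -/
def derivRoot : AdjoinRoot M :=
  - AdjoinRoot.mk M (Differential.mapCoeffs M) / AdjoinRoot.mk M (derivative M)

/-- The derivative of the element `p(y)` of `F[y]/⟨M⟩`. -/
def derivOfRepresentative (p : F[X]) : AdjoinRoot M :=
  AdjoinRoot.mk M (Differential.mapCoeffs p) + AdjoinRoot.mk M (derivative p) * derivRoot d M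

theorem mk_derivative_ne_zero : AdjoinRoot.mk M (derivative M) ≠ 0 := by
  rw [ne_eq, AdjoinRoot.mk_eq_zero]
  have h : 0 < M.natDegree := Irreducible.natDegree_pos (Fact.out)
  apply not_dvd_of_natDegree_lt
  · intro nh
    have := derivative_eq_zero.1 nh
    omega
  · exact natDegree_derivative_lt h.ne'

theorem derivOfRepresentative_add (p q : F[X]) :
    derivOfRepresentative d M (p + q) =
      derivOfRepresentative d M p + derivOfRepresentative d M q := by
  simp only [derivOfRepresentative, map_add]
  ring

theorem derivOfRepresentative_mul (p q : F[X]) :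
    derivOfRepresentative d M (p * q) =
      AdjoinRoot.mk M p * derivOfRepresentative d M q +
        AdjoinRoot.mk M q * derivOfRepresentative d M p := by
  simp only [derivOfRepresentative, Derivation.leibniz, derivative_mul, map_add, map_mul,
    smul_eq_mul]
  ring

theorem derivOfRepresentative_congr (p q : F[X]) (h : AdjoinRoot.mk M p = AdjoinRoot.mk M q) :
    derivOfRepresentative d M p = derivOfRepresentative d M q := by
  obtain ⟨r, hr⟩ := AdjoinRoot.mk_eq_mk.1 h
  have hM : derivOfRepresentative d M M = 0 := by
    rw [derivOfRepresentative, derivRoot, mul_div_cancel₀ _ (mk_derivative_ne_zero M)]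
    simp
  have hp : p = M * r + q := by rw [← hr]; ring
  rw [hp, derivOfRepresentative_add, derivOfRepresentative_mul, hM]
  simp

/-- The unique extension of a derivation `d` of a field `F` of characteristic zero to
`F[y]/⟨M⟩`, for an irreducible polynomial `M`. -/
@[reducible] def differentialAdjoinRoot : Differential (AdjoinRoot M) :=
  mkDifferential
    (fun a => derivOfRepresentative d M (Function.surjInv AdjoinRoot.mk_surjective a))
    (by
      intro a b
      rw [← derivOfRepresentative_add]
      apply derivOfRepresentative_congr
      simp [Function.surjInv_eq])
    (by
      intro a b
      nth_rewrite 2 [← Function.surjInv_eq AdjoinRoot.mk_surjective a]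
      nth_rewrite 3 [← Function.surjInv_eq AdjoinRoot.mk_surjective b]
      rw [← derivOfRepresentative_mul]
      apply derivOfRepresentative_congr
      simp [Function.surjInv_eq])

theorem differentialAdjoinRoot_mk (p : F[X]) :
    (differentialAdjoinRoot d M).deriv (AdjoinRoot.mk M p) = derivOfRepresentative d M p :=
  derivOfRepresentative_congr d M _ _ (Function.surjInv_eq AdjoinRoot.mk_surjective _)

theorem differentialAdjoinRoot_algebraMap (c : F) :
    (differentialAdjoinRoot d M).deriv (algebraMap F (AdjoinRoot M) c) =
      algebraMap F (AdjoinRoot M) (d.deriv c) := by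
  refine (differentialAdjoinRoot_mk d M (Polynomial.C c)).trans ?_
  simp [derivOfRepresentative, AdjoinRoot.algebraMap_eq]

end AdjoinRootDerivation

end Derivations

/-! ### The field of algebraic functions -/

section AlgebraicFunctions

variable {K : Type*} [Field K]

/-- The polynomial `m ∈ K[x][y]` is absolutely irreducible, i.e. irreducible over the algebraic
closure of `K`, and has positive degree in `y`. -/
class IsDefiningPolynomial (m : K[X][X]) : Prop where
  absolutelyIrreducible :
    Irreducible (m.map (mapRingHom (algebraMap K (AlgebraicClosure K))))
  natDegree_pos : 0 < m.natDegree

/-- The polynomial `m`, viewed as an element of `K(x)[y]`. -/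
abbrev overRatFunc (m : K[X][X]) : (RatFunc K)[X] := m.map (algebraMap K[X] (RatFunc K))

instance (m : K[X][X]) [hm : IsDefiningPolynomial m] : Fact (Irreducible (overRatFunc m)) := by
  refine ⟨?_⟩
  have hinj : Function.Injective (mapRingHom (algebraMap K (AlgebraicClosure K))) :=
    map_injective _ (algebraMap K (AlgebraicClosure K)).injective
  have hloc : IsLocalHom (mapRingHom (mapRingHom (algebraMap K (AlgebraicClosure K)))) := by
    refine ⟨fun p hp => ?_⟩
    obtain ⟨r, hr, hrp⟩ := Polynomial.isUnit_iff.1 hp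
    obtain ⟨c, hc, hcr⟩ := Polynomial.isUnit_iff.1 hr
    have hp0 : p.natDegree = 0 := by
      have := congrArg natDegree hrp
      rw [natDegree_C, coe_mapRingHom, natDegree_map_eq_of_injective hinj] at this
      exact this.symm
    obtain ⟨q, rfl⟩ := natDegree_eq_zero.1 hp0
    have h1 : Polynomial.C c = q.map (algebraMap K (AlgebraicClosure K)) := by
      rw [hcr]
      apply C_injective
      rw [hrp]
      simp
    have hq0 : q.natDegree = 0 := by
      have := congrArg natDegree h1
      rw [natDegree_C, natDegree_map] at this
      exact this.symm
    obtain ⟨b, rfl⟩ := natDegree_eq_zero.1 hq0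
    have hb : b ≠ 0 := by
      rintro rfl
      simp at h1
      exact hc.ne_zero h1
    exact isUnit_C.2 (isUnit_C.2 hb.isUnit)
  have hirr : Irreducible m := by
    have := hm.absolutelyIrreducible
    exact Irreducible.of_map
      (f := mapRingHom (mapRingHom (algebraMap K (AlgebraicClosure K)))) this
  exact ((hirr.isPrimitive hm.natDegree_pos.ne').irreducible_iff_irreducible_map_fraction_map).1 hirr

/-- The field `A = K(x)[y]/⟨m⟩`. -/
abbrev AlgFun (m : K[X][X]) : Type _ := AdjoinRoot (overRatFunc m)

variable [CharZero K] (m : K[X][X]) [IsDefiningPolynomial m]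

/-- The derivation `f ↦ f'` of `A` with respect to `x`; it vanishes on `K`, and `x' = 1`. -/
def dx : AlgFun m → AlgFun m :=
  (differentialAdjoinRoot (differentialVar K) (overRatFunc m)).deriv

/-- The derivation of `A` that extends the derivation `δ` of `K` and sends `x` to `0`. -/
def dt (δ : Differential K) : AlgFun m → AlgFun m :=
  (differentialAdjoinRoot (differentialCoeff δ) (overRatFunc m)).deriv

theorem dx_add (f g : AlgFun m) : dx m (f + g) = dx m f + dx m g := map_add _ f g

theorem dx_mul (f g : AlgFun m) : dx m (f * g) = f * dx m g + g * dx m f :=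
  differential_mul _ f g

theorem dx_algebraMap (p : K[X]) :
    dx m (algebraMap K[X] (AlgFun m) p) = algebraMap K[X] (AlgFun m) (derivative p) := by
  rw [IsScalarTower.algebraMap_apply K[X] (RatFunc K) (AlgFun m),
    IsScalarTower.algebraMap_apply K[X] (RatFunc K) (AlgFun m), dx,
    differentialAdjoinRoot_algebraMap, ratFuncDifferential_algebraMap]
  rfl

theorem dt_add (δ : Differential K) (f g : AlgFun m) : dt m δ (f + g) = dt m δ f + dt m δ g :=
  map_add _ f g

theorem dt_mul (δ : Differential K) (f g : AlgFun m) :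
    dt m δ (f * g) = f * dt m δ g + g * dt m δ f :=
  differential_mul _ f g

theorem dt_const (δ : Differential K) (c : K) :
    dt m δ (algebraMap K (AlgFun m) c) = algebraMap K (AlgFun m) (δ.deriv c) := by
  rw [IsScalarTower.algebraMap_apply K (RatFunc K) (AlgFun m),
    IsScalarTower.algebraMap_apply K (RatFunc K) (AlgFun m),
    IsScalarTower.algebraMap_apply K K[X] (RatFunc K),
    IsScalarTower.algebraMap_apply K K[X] (RatFunc K), dt,
    differentialAdjoinRoot_algebraMap, ratFuncDifferential_algebraMap]
  simp

theorem dt_x (δ : Differential K) : dt m δ (algebraMap K[X] (AlgFun m) X) = 0 := by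
  rw [IsScalarTower.algebraMap_apply K[X] (RatFunc K) (AlgFun m), dt,
    differentialAdjoinRoot_algebraMap, ratFuncDifferential_algebraMap]
  simp

/-- `f` is integrable in `A`. -/
def IsIntegrable (f : AlgFun m) : Prop := ∃ g : AlgFun m, dx m g = f

end AlgebraicFunctions

/-! ### Puiseux series and integrality -/

section Puiseux

/-- The embedding of `k((z^{1/r}))` into the field of Hahn series in `z` with rational exponents:
the integer exponent `n` becomes `n / r`. -/
def ramified (k : Type*) [Field k] (r : ℕ+) : HahnSeries ℤ k →+* HahnSeries ℚ k :=
  HahnSeries.embDomainRingHom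
    (AddMonoidHom.mk' (fun n : ℤ => (n : ℚ) / (r : ℕ)) (by intro a b; push_cast; ring))
    (by
      intro a b h
      have hr : ((r : ℕ) : ℚ) ≠ 0 := by exact_mod_cast r.ne_zero
      simpa [div_left_inj' hr] using h)
    (by
      intro a b
      have hr : (0 : ℚ) < ((r : ℕ) : ℚ) := by exact_mod_cast r.pos
      simp [div_le_div_iff_of_pos_right hr])

/-- The field of Puiseux series `⋃_{r ≥ 1} k((z^{1/r}))`. -/
def PuiseuxSeries (k : Type*) [Field k] : Subfield (HahnSeries ℚ k) :=
  ⨆ r : ℕ+, (ramified k r).fieldRange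

variable {K : Type*} [Field K]

/-- The expansion of `x` at a point `a` of `K̄ ∪ {∞}`, in terms of the local parameter `z`:
it is `a + z` with `z = x - a` if `a` is finite, and `z⁻¹` with `z = x⁻¹` if `a = ∞`. -/
def xAt : OnePoint (AlgebraicClosure K) → HahnSeries ℚ (AlgebraicClosure K)
  | OnePoint.infty => HahnSeries.single (-1) 1
  | OnePoint.some a => HahnSeries.C a + HahnSeries.single 1 1

variable [CharZero K] (m : K[X][X]) [IsDefiningPolynomial m]

/-- The natural ring homomorphisms from `A` to the Puiseux series around `a`: those that restrict
to the expansion of rational functions at `a`. They correspond to the Puiseux series solutions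
`φ y` of `m = 0`. -/
def IsExpansionAt (a : OnePoint (AlgebraicClosure K))
    (φ : AlgFun m →+* PuiseuxSeries (AlgebraicClosure K)) : Prop :=
  (∀ c : K, (φ (algebraMap K (AlgFun m) c) : HahnSeries ℚ (AlgebraicClosure K)) =
    HahnSeries.C (algebraMap K (AlgebraicClosure K) c)) ∧
  (φ (algebraMap K[X] (AlgFun m) X) : HahnSeries ℚ (AlgebraicClosure K)) = xAt a

/-- Every series around `a` associated to `f` only contains terms `z ^ α` with `α ≥ β`. -/
def HasOrderAtLeast (a : OnePoint (AlgebraicClosure K)) (β : ℚ) (f : AlgFun m) : Prop :=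
  ∀ φ : AlgFun m →+* PuiseuxSeries (AlgebraicClosure K), IsExpansionAt m a φ →
    ∀ α ∈ (φ f : HahnSeries ℚ (AlgebraicClosure K)).support, β ≤ α

/-- `f` is (locally) integral at `a`. -/
def IsIntegralAt (a : OnePoint (AlgebraicClosure K)) (f : AlgFun m) : Prop :=
  HasOrderAtLeast m a 0 f

/-- `f` is (globally) integral: locally integral at all finite places. -/
def IsGloballyIntegral (f : AlgFun m) : Prop :=
  ∀ a : AlgebraicClosure K, IsIntegralAt m (OnePoint.some a) f

/-- `f` has a double root at infinity. -/
def HasDoubleRootAtInfinity (f : AlgFun m) : Prop :=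
  HasOrderAtLeast m OnePoint.infty 2 f

/-- `W` is an integral basis of `A`: a basis of the `K[x]`-module of globally integral elements. -/
def IsIntegralBasis (W : Fin m.natDegree → AlgFun m) : Prop :=
  LinearIndependent K[X] W ∧
    ∀ f : AlgFun m, f ∈ Submodule.span K[X] (Set.range W) ↔ IsGloballyIntegral m f

/-- The ring `K(x)_∞` of rational functions `p / q` with `deg p ≤ deg q`. -/
def RatFuncAtInfinity (K : Type*) [Field K] : Subring (RatFunc K) where
  carrier := {f | ∃ p q : K[X], q ≠ 0 ∧ p.degree ≤ q.degree ∧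
    f = algebraMap K[X] (RatFunc K) p / algebraMap K[X] (RatFunc K) q}
  zero_mem' := ⟨0, 1, by simp⟩
  one_mem' := ⟨1, 1, by simp⟩
  neg_mem' := by
    rintro _ ⟨p, q, hq, hpq, rfl⟩
    exact ⟨-p, q, hq, by simpa using hpq, by simp [neg_div]⟩
  mul_mem' := by
    rintro _ _ ⟨p, q, hq, hpq, rfl⟩ ⟨p', q', hq', hpq', rfl⟩
    refine ⟨p * p', q * q', mul_ne_zero hq hq', ?_, by simp [div_mul_div_comm]⟩
    rw [degree_mul, degree_mul]
    exact add_le_add hpq hpq'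
  add_mem' := by
    rintro _ _ ⟨p, q, hq, hpq, rfl⟩ ⟨p', q', hq', hpq', rfl⟩
    refine ⟨p * q' + q * p', q * q', mul_ne_zero hq hq', ?_, ?_⟩
    · refine (degree_add_le _ _).trans (max_le ?_ ?_)
      · rw [degree_mul, degree_mul]
        exact add_le_add hpq le_rfl
      · rw [degree_mul, degree_mul]
        exact add_le_add le_rfl hpq'
    · rw [div_add_div _ _ ((map_ne_zero_iff _ (RatFunc.algebraMap_injective K)).2 hq)
        ((map_ne_zero_iff _ (RatFunc.algebraMap_injective K)).2 hq')]
      simp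

/-- `V` is a local integral basis of `A` at infinity: a basis of the `K(x)_∞`-module of elements
that are integral at infinity. -/
def IsLocalIntegralBasisAtInfinity (V : Fin m.natDegree → AlgFun m) : Prop :=
  LinearIndependent (RatFuncAtInfinity K) V ∧
    ∀ f : AlgFun m, f ∈ Submodule.span (RatFuncAtInfinity K) (Set.range V) ↔
      IsIntegralAt m OnePoint.infty f

/-- `W` is normal at infinity. -/
def IsNormalAtInfinity (W : Fin m.natDegree → AlgFun m) : Prop :=
  ∃ r : Fin m.natDegree → RatFunc K, IsLocalIntegralBasisAtInfinity m fun i => r i • W i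

end Puiseux

/-! ### Hermite reduction -/

section Hermite

variable {K : Type*} [Field K] [CharZero K] (m : K[X][X]) [IsDefiningPolynomial m]

/-- The element `∑ i, (F i / D) ω_i` of `A`. -/
def combination (W : Fin m.natDegree → AlgFun m) (D : K[X]) (F : Fin m.natDegree → K[X]) :
    AlgFun m :=
  ∑ i, (algebraMap K[X] (RatFunc K) (F i) / algebraMap K[X] (RatFunc K) D) • W i

/-- `e` is the denominator of the derivatives of the basis elements: `e ω_i' = ∑ j, M i j ω_j`
with polynomials `M i j` such that `e` and all the `M i j` have no common factor. -/
def IsDerivativeDenominator (W : Fin m.natDegree → AlgFun m) (e : K[X]) : Prop :=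
  ∃ M : Matrix (Fin m.natDegree) (Fin m.natDegree) K[X],
    (∀ i, e • dx m (W i) = ∑ j, M i j • W j) ∧
    ∀ p : K[X], p ∣ e → (∀ i j, p ∣ M i j) → IsUnit p

/-- `HermiteSteps m W D F g h`: repeated steps of Hermite reduction, started at
`∑ i, (F i / D) ω_i` and continued until the denominator is squarefree, yield the
integrated part `g` and the remainder `h`.

A step takes a factor `v` of `D` of multiplicity `μ > 1`, so that `D = u v^μ`, and writes
`∑ i, (F i / (u v^μ)) ω_i = (∑ i, (G i / v^(μ-1)) ω_i)' + ∑ i, (H i / (u v^(μ-1))) ω_i`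
with `deg (G i) < deg v`. -/
inductive HermiteSteps (W : Fin m.natDegree → AlgFun m) :
    K[X] → (Fin m.natDegree → K[X]) → AlgFun m → AlgFun m → Prop
  | done (D : K[X]) (F : Fin m.natDegree → K[X]) (hD : Squarefree D) :
      HermiteSteps W D F 0 (combination m W D F)
  | step (u v : K[X]) (μ : ℕ) (F G H : Fin m.natDegree → K[X]) (g h : AlgFun m)
      (hμ : 1 < μ) (hv : ¬ IsUnit v) (hsq : Squarefree v) (huv : IsCoprime u v)
      (hdeg : ∀ i, (G i).degree < v.degree)
      (heq : combination m W (u * v ^ μ) F =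
        dx m (combination m W (v ^ (μ - 1)) G) + combination m W (u * v ^ (μ - 1)) H)
      (hrest : HermiteSteps W (u * v ^ (μ - 1)) H g h) :
      HermiteSteps W (u * v ^ μ) F (combination m W (v ^ (μ - 1)) G + g) h

/-- `f = g' + h` is a result of the Hermite reduction of `f` with respect to the integral basis
`W`. The reduction starts from a representation `f = ∑ i, (F i / D) ω_i` where `D` is a multiple of
the denominator `e` of the derivatives of the basis elements. -/
def IsHermiteReduction (W : Fin m.natDegree → AlgFun m) (f g h : AlgFun m) : Prop :=
  ∃ (e D : K[X]) (F : Fin m.natDegree → K[X]), IsDerivativeDenominator m W e ∧ D ≠ 0 ∧ e ∣ D ∧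
    f = combination m W D F ∧ HermiteSteps m W D F g h

theorem HermiteSteps.eq {W : Fin m.natDegree → AlgFun m} {D : K[X]}
    {F : Fin m.natDegree → K[X]} {g h : AlgFun m} (hs : HermiteSteps m W D F g h) :
    combination m W D F = dx m g + h := by
  induction hs with
  | done D F hD =>
    have h0 : dx m 0 = 0 := by simpa using dx_add m 0 0
    rw [h0, zero_add]
  | step u v μ F G H g h hμ hv hsq huv hdeg heq hrest ih => rw [heq, ih, dx_add, add_assoc]

/-- The result of a Hermite reduction is a decomposition `f = g' + h`. -/
theorem IsHermiteReduction.eq {W : Fin m.natDegree → AlgFun m} {f g h : AlgFun m}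
    (hr : IsHermiteReduction m W f g h) : f = dx m g + h := by
  obtain ⟨e, D, F, -, -, -, rfl, hs⟩ := hr
  exact hs.eq

end Hermite

/-! ### Creative telescoping -/

section Telescoping

variable {K : Type*} [Field K] [CharZero K] (δ : Differential K) (m : K[X][X])
  [IsDefiningPolynomial m]

/-- The action of the operator `∑ i, (p i) ∂_t ^ i`, with coefficients `p i ∈ K`, on `A`. -/
def applyOperator (p : ℕ →₀ K) (f : AlgFun m) : AlgFun m :=
  p.sum fun i c => c • (dt m δ)^[i] f

/-- The order of the operator `∑ i, (p i) ∂_t ^ i`, with value `0` for the zero operator. -/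
def operatorOrder (p : ℕ →₀ K) : ℕ := p.support.sup id

/-- `p` is a telescoper for `f`: it is nonzero, and `p · f` is integrable in `A`. -/
def IsTelescoper (p : ℕ →₀ K) (f : AlgFun m) : Prop :=
  p ≠ 0 ∧ IsIntegrable m (applyOperator δ m p f)

/-- `h i` is a Hermite remainder of `∂_t ^ i · f`, for each `i`. -/
def AreHermiteRemainders (W : Fin m.natDegree → AlgFun m) (f : AlgFun m) (h : ℕ → AlgFun m) :
    Prop :=
  ∀ i, ∃ g, IsHermiteReduction m W ((dt m δ)^[i] f) g (h i)

/-- The result of the search for the first linear relation over `K` among `h 0, h 1, h 2, …`: the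
elements `h 0, …, h (r - 1)` are linearly independent, and `p 0, …, p r` are the coefficients of a
nontrivial relation of `h 0, …, h r`. The output of the procedure is the operator
`∑ i, (p i) ∂_t ^ i`. -/
def IsFirstRelation (h : ℕ → AlgFun m) (r : ℕ) (p : ℕ →₀ K) : Prop :=
  LinearIndependent K (fun i : Fin r => h i) ∧ p ≠ 0 ∧ (∀ i, r < i → p i = 0) ∧
    (p.sum fun i c => c • h i) = 0

end Telescoping

end AlgTelescoping

end

open AlgTelescoping Polynomial

open Polynomial

noncomputable section

/-! In an output `f = g' + h`, the coefficients of `g` with respect to `W` are proper fractions, and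
`h`, having a squarefree denominator, only has exponents `≥ -1` at finite places. Suppose `f = F'`
and put `H = F - g`, so that `H' = h`. A term `z^α` with `α < 0` in `H` would give `z^(α-1)` in `h`,
so `H` has no finite poles. At infinity, the double root of `F'` makes `F` integral, and normality
turns integrality into a separate degree bound `τ i` for each coefficient. Either `-1 ≤ τ i`, and
the proper fraction from `g` respects the bound too, or the coefficient of `H` is a polynomial of
degree at most `-1`, hence zero. So `H` has no poles at all. Such elements form a finite dimensional
algebra over `K`, so `H` is algebraic over `K` and `h = H' = 0` (`remainder_eq_zero`,
`dx_eq_zero_of_integral`).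

The derivation `∂_t` acts coefficientwise on expansions in `1/x` and so preserves the double root.
Since `P · f = (∑ p_i g_i)' + ∑ p_i h_i` has the same shape, the same argument shows that a nonzero
`P` is a telescoper exactly when `∑ p_i h_i = 0`. Minimality of the order is then linear algebra.

A relation exists because the `h_i` span a finite dimensional space. The powers of one polynomial
`Q` clear the denominators of all `∂_t^k f`, and a squarefree divisor of a power of `Q` divides `Q`.
This controls one particular choice of outputs; by `remainder_unique` the remainders do not depend
on the choice. Their degrees are bounded, since `∂_t^k f` is integral at infinity and `g` has proper
coefficients.

Outputs exist because `z d/dz` preserves integrality: this makes `e` squarefree, and it makes each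
step a linear system modulo `v` with trivial kernel (`isGloballyIntegral_div_of_hermite`). -/

namespace AlgTelescoping

set_option linter.unusedSectionVars false

/-! ### Lower bounds on the exponents of a series. -/

section HahnSeriesOrder

variable {k : Type*} [Field k]

/-- All exponents of the series `s` are at least `β`. -/
def OrdGE (β : ℚ) (s : HahnSeries ℚ k) : Prop := ∀ α ∈ s.support, β ≤ α

/-- Sums are easy to treat through supports, products through `orderTop`, which is additive over a
field. -/
theorem ordGE_iff {β : ℚ} {s : HahnSeries ℚ k} : OrdGE β s ↔ (β : WithTop ℚ) ≤ s.orderTop := by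
  rw [HahnSeries.le_orderTop_iff_forall]
  constructor
  · intro h j hj
    by_contra hne
    exact absurd (h j hne) (not_le.2 (by exact_mod_cast hj))
  · intro h α hα
    by_contra hlt
    exact hα (h α (by exact_mod_cast not_le.1 hlt))

theorem OrdGE.mono {β γ : ℚ} {s : HahnSeries ℚ k} (h : OrdGE β s) (hle : γ ≤ β) : OrdGE γ s :=
  fun α hα => hle.trans (h α hα)

theorem OrdGE.of_support_subset {β : ℚ} {s t : HahnSeries ℚ k} (h : OrdGE β s)
    (hst : ∀ α, s.coeff α = 0 → t.coeff α = 0) : OrdGE β t :=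
  fun α hα => h α fun h0 => hα (hst α h0)

theorem ordGE_zero (β : ℚ) : OrdGE β (0 : HahnSeries ℚ k) := fun α hα => by simp at hα

theorem OrdGE.add {β : ℚ} {s t : HahnSeries ℚ k} (hs : OrdGE β s) (ht : OrdGE β t) :
    OrdGE β (s + t) := by
  intro α hα
  by_cases h : α ∈ s.support
  · exact hs α h
  · refine ht α fun h0 => hα ?_
    rw [HahnSeries.mem_support, not_not] at h
    simp [h, h0]

theorem OrdGE.neg {β : ℚ} {s : HahnSeries ℚ k} (hs : OrdGE β s) : OrdGE β (-s) :=
  hs.of_support_subset (by simp)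

theorem OrdGE.sub {β : ℚ} {s t : HahnSeries ℚ k} (hs : OrdGE β s) (ht : OrdGE β t) :
    OrdGE β (s - t) := by
  rw [sub_eq_add_neg]
  exact hs.add ht.neg

theorem OrdGE.mul {β γ : ℚ} {s t : HahnSeries ℚ k} (hs : OrdGE β s) (ht : OrdGE γ t) :
    OrdGE (β + γ) (s * t) := by
  rw [ordGE_iff] at *
  rw [HahnSeries.orderTop_mul, WithTop.coe_add]
  exact add_le_add hs ht

theorem OrdGE.mul_left {β : ℚ} {s t : HahnSeries ℚ k} (hs : OrdGE 0 s) (ht : OrdGE β t) :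
    OrdGE β (s * t) := by
  simpa using hs.mul ht

theorem ordGE_C (c : k) : OrdGE 0 (HahnSeries.C c : HahnSeries ℚ k) := by
  intro α hα
  rw [HahnSeries.mem_support, HahnSeries.C_apply, HahnSeries.coeff_single] at hα
  split_ifs at hα with h
  · exact h.ge
  · exact absurd rfl hα

theorem ordGE_single (β : ℚ) (c : k) : OrdGE β (HahnSeries.single β c : HahnSeries ℚ k) := by
  intro α hα
  rw [HahnSeries.mem_support, HahnSeries.coeff_single] at hα
  split_ifs at hα with h
  · exact h.ge
  · exact absurd rfl hα

theorem ordGE_single_mul_iff {β γ : ℚ} {s : HahnSeries ℚ k} :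
    OrdGE β (HahnSeries.single γ 1 * s) ↔ OrdGE (β - γ) s := by
  constructor
  · intro h
    have := (ordGE_single (-γ) (1 : k)).mul h
    rw [← mul_assoc, HahnSeries.single_mul_single] at this
    simpa [sub_eq_neg_add] using this
  · intro h
    simpa using (ordGE_single γ (1 : k)).mul h

theorem OrdGE.of_mul_left {β : ℚ} {u s : HahnSeries ℚ k} (hu : u.orderTop = 0)
    (h : OrdGE β (u * s)) : OrdGE β s := by
  rw [ordGE_iff] at *
  rwa [HahnSeries.orderTop_mul, hu, zero_add] at h

/-- A sum of a nonzero constant and a series with exponents at least `1` has order `0`. -/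
theorem orderTop_C_add {c : k} (hc : c ≠ 0) {s : HahnSeries ℚ k} (hs : OrdGE 1 s) :
    (HahnSeries.C c + s).orderTop = 0 := by
  have hC : (HahnSeries.C c : HahnSeries ℚ k).orderTop = 0 := by
    rw [HahnSeries.C_apply, HahnSeries.orderTop_single hc]
    rfl
  rw [HahnSeries.orderTop_add_eq_left, hC]
  rw [hC]
  exact lt_of_lt_of_le (by exact_mod_cast zero_lt_one) (ordGE_iff.1 hs)

end HahnSeriesOrder

/-! ### Derivations of the field of series. -/

section HahnSeriesDerivation

variable {k : Type*} [Field k]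

/-- The map `∑ c_α z^α ↦ ∑ (δ c_α + l α c_α) z^α` on series. -/
def twist (δ : Derivation ℤ k k) (l : k) (s : HahnSeries ℚ k) : HahnSeries ℚ k where
  coeff α := δ (s.coeff α) + l * α * s.coeff α
  isPWO_support' := s.isPWO_support.mono fun α hα h0 => hα (by simp [h0])

@[simp] theorem coeff_twist (δ : Derivation ℤ k k) (l : k) (s : HahnSeries ℚ k) (α : ℚ) :
    (twist δ l s).coeff α = δ (s.coeff α) + l * α * s.coeff α := rfl

theorem coeff_twist_eq_zero (δ : Derivation ℤ k k) (l : k) {s : HahnSeries ℚ k} {α : ℚ}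
    (h : s.coeff α = 0) : (twist δ l s).coeff α = 0 := by simp [h]

theorem OrdGE.twist {β : ℚ} {s : HahnSeries ℚ k} (h : OrdGE β s) (δ : Derivation ℤ k k) (l : k) :
    OrdGE β (AlgTelescoping.twist δ l s) :=
  h.of_support_subset fun _ => coeff_twist_eq_zero δ l

/-- The product rule holds termwise, because `δ` satisfies it and the weight `l * α` is additive in
the exponent. Supports only shrink under `twist`, so all three products can be summed over the same
pairs of exponents. -/
theorem twist_mul [CharZero k] (δ : Derivation ℤ k k) (l : k) (s t : HahnSeries ℚ k) :
    twist δ l (s * t) = s * twist δ l t + t * twist δ l s := by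
  ext α
  have hs : (twist δ l s).support ⊆ s.support := fun α hα h0 => hα (coeff_twist_eq_zero δ l h0)
  have ht : (twist δ l t).support ⊆ t.support := fun α hα h0 => hα (coeff_twist_eq_zero δ l h0)
  rw [HahnSeries.coeff_add, mul_comm t, HahnSeries.coeff_mul_right' t.isPWO_support ht,
    HahnSeries.coeff_mul_left' s.isPWO_support hs, coeff_twist, HahnSeries.coeff_mul, map_sum,
    Finset.mul_sum, ← Finset.sum_add_distrib, ← Finset.sum_add_distrib]
  refine Finset.sum_congr rfl fun ij hij => ?_
  obtain ⟨-, -, h⟩ := Finset.mem_antidiagonal.1 hij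
  rw [← h]
  simp only [Derivation.leibniz, coeff_twist, smul_eq_mul, Rat.cast_add]
  ring

theorem twist_add (δ : Derivation ℤ k k) (l : k) (s t : HahnSeries ℚ k) :
    twist δ l (s + t) = twist δ l s + twist δ l t := by
  ext α
  simp only [coeff_twist, HahnSeries.coeff_add, map_add]
  ring

/-- The Euler operator `z d/dz`. -/
def euler (s : HahnSeries ℚ k) : HahnSeries ℚ k := twist 0 1 s

theorem coeff_euler (s : HahnSeries ℚ k) (α : ℚ) : (euler s).coeff α = α * s.coeff α := by
  simp [euler]

theorem OrdGE.euler {β : ℚ} {s : HahnSeries ℚ k} (h : OrdGE β s) :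
    OrdGE β (AlgTelescoping.euler s) :=
  h.twist _ _

/-- A term with negative exponent survives the Euler operator. The bound drops from `β` to `0`
because the constant term is killed. -/
theorem ordGE_of_euler [CharZero k] {β : ℚ} {s : HahnSeries ℚ k} (hβ : 0 ≤ β)
    (h : OrdGE β (euler s)) : OrdGE 0 s := by
  intro α hα
  by_contra hlt
  refine absurd (h α ?_) (not_le.2 ((not_le.1 hlt).trans_le hβ))
  rw [HahnSeries.mem_support, coeff_euler]
  exact mul_ne_zero (by exact_mod_cast (not_le.1 hlt).ne) hα

/-- If `z s' - c s` has exponents at least `β` only, and `β ≤ c`, then so has `s`. -/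
theorem ordGE_of_euler_sub [CharZero k] {β : ℚ} (c : ℚ) (hc : β ≤ c) {s : HahnSeries ℚ k}
    (h : OrdGE β (euler s - HahnSeries.C (c : k) * s)) : OrdGE β s := by
  intro α hα
  by_contra hlt
  refine absurd (h α ?_) hlt
  rw [HahnSeries.mem_support, HahnSeries.coeff_sub, coeff_euler, HahnSeries.C_mul_eq_smul,
    HahnSeries.coeff_smul, smul_eq_mul, ← sub_mul]
  -- The operator multiplies the coefficient at `α` by `α - c`, which is nonzero for `α < β ≤ c`.
  refine mul_ne_zero ?_ hα
  rw [sub_ne_zero]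
  exact_mod_cast ((not_le.1 hlt).trans_le hc).ne

theorem twist_C (δ : Derivation ℤ k k) (l c : k) :
    twist δ l (HahnSeries.C c) = HahnSeries.C (δ c) := by
  ext α
  rw [coeff_twist]
  simp only [HahnSeries.C_apply, HahnSeries.coeff_single]
  split_ifs with h <;> simp [h]

theorem twist_single (δ : Derivation ℤ k k) (l : k) (γ : ℚ) :
    twist δ l (HahnSeries.single γ 1) = HahnSeries.single γ (l * γ) := by
  ext α
  rw [coeff_twist]
  simp only [HahnSeries.coeff_single]
  split_ifs with h <;> simp [h]

end HahnSeriesDerivation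

/-! ### Extension of derivations to algebraic extensions. -/

section ExtendDerivation

/-- A derivation of a field of characteristic zero extends to every algebraic extension. -/
theorem exists_derivation_extension {K L : Type*} [Field K] [CharZero K] [Field L] [Algebra K L]
    [Algebra.IsAlgebraic K L] (δ : Derivation ℤ K K) :
    ∃ δ' : Derivation ℤ L L, ∀ c, δ' (algebraMap K L c) = algebraMap K L (δ c) := by
  -- Étaleness identifies the differentials of `L` with the base change of those of `K`, so the
  -- linear form on the latter given by `δ` carries over to the former.
  have : Algebra.FormallyEtale K L := Algebra.FormallyEtale.of_isSeparable K L
  let D : Derivation ℤ K L := (Algebra.linearMap K L).compDer δ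
  let l : TensorProduct K L (Ω[K⁄ℤ]) →ₗ[L] L := D.liftKaehlerDifferential.liftBaseChange L
  let e := KaehlerDifferential.tensorKaehlerEquivOfFormallyEtale ℤ K L
  refine ⟨(l ∘ₗ e.symm.toLinearMap).compDer (KaehlerDifferential.D ℤ L), fun c => ?_⟩
  have h1 : e.symm (KaehlerDifferential.D ℤ L (algebraMap K L c)) = _ :=
    KaehlerDifferential.tensorKaehlerEquivOfFormallyEtale_symm_D_algebraMap ℤ K L c
  simp [h1, l, D]

end ExtendDerivation

/-! ### Expansions of polynomials at a finite point. -/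

section Taylor

variable {k : Type*} [Field k]

/-- The expansion of polynomials in powers of `z = x - a`. -/
def taylorAt (a : k) : k[X] →+* HahnSeries ℚ k :=
  eval₂RingHom HahnSeries.C (HahnSeries.C a + HahnSeries.single 1 1)

theorem taylorAt_C (a c : k) : taylorAt a (C c) = HahnSeries.C c := by simp [taylorAt]

theorem taylorAt_X_sub_C_mul (a : k) (q : k[X]) :
    taylorAt a ((X - C a) * q) = HahnSeries.single 1 1 * taylorAt a q := by
  rw [map_mul]
  simp [taylorAt]

theorem ordGE_taylorAt (a : k) (q : k[X]) : OrdGE 0 (taylorAt a q) := by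
  induction q using Polynomial.induction_on' with
  | add p q hp hq => rw [map_add]; exact hp.add hq
  | monomial n c =>
    rw [← C_mul_X_pow_eq_monomial, map_mul, taylorAt_C, map_pow]
    refine (ordGE_C c).mul_left ?_
    induction n with
    | zero => simpa using ordGE_C (1 : k)
    | succ n ih =>
      rw [pow_succ]
      refine ih.mul_left ?_
      simp only [taylorAt, coe_eval₂RingHom, eval₂_X]
      exact (ordGE_C a).add ((ordGE_single 1 1).mono zero_le_one)

/-- Division by `X - a` exhibits `q(a)` as the constant term; everything else is divisible by `z`.
-/
theorem orderTop_taylorAt {a : k} {q : k[X]} (h : q.eval a ≠ 0) : (taylorAt a q).orderTop = 0 := by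
  have hq : q = C (q.eval a) + (X - C a) * (q /ₘ (X - C a)) := by
    rw [← modByMonic_X_sub_C_eq_C_eval]
    exact (modByMonic_add_div q _).symm
  rw [hq, map_add, taylorAt_C, taylorAt_X_sub_C_mul]
  refine orderTop_C_add h ?_
  simpa using (ordGE_single 1 (1 : k)).mul (ordGE_taylorAt a _)

end Taylor

/-! ### Expansions of algebraic functions, and how the derivations act on them. -/

section Expansions

variable {K : Type*} [Field K] [CharZero K] (m : K[X][X]) [IsDefiningPolynomial m]

/-- The field of series in fractional powers of `z` that contains the expansions. -/
abbrev Series (K : Type*) [Field K] : Type _ := HahnSeries ℚ (AlgebraicClosure K)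

instance : Algebra.IsAlgebraic (RatFunc K) (AlgFun m) :=
  have : FiniteDimensional (RatFunc K) (AlgFun m) :=
    (AdjoinRoot.powerBasis
      (Irreducible.ne_zero (Fact.out : Irreducible (overRatFunc m)))).finite
  Algebra.IsAlgebraic.of_finite _ _

theorem algebraMap_polynomial_ne_zero {p : K[X]} (hp : p ≠ 0) :
    algebraMap K[X] (AlgFun m) p ≠ 0 := by
  rw [IsScalarTower.algebraMap_apply K[X] (RatFunc K) (AlgFun m)]
  exact (_root_.map_ne_zero _).2 ((map_ne_zero_iff _ (RatFunc.algebraMap_injective K)).2 hp)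

variable {m}

/-- Maps into the series are compatible with derivations as soon as they are on constants and
on `x`. -/
theorem comm_derivation (ψ : AlgFun m →+* Series K) (d : AlgFun m → AlgFun m)
    (D : Series K → Series K) (hda : ∀ f g, d (f + g) = d f + d g)
    (hdm : ∀ f g, d (f * g) = f * d g + g * d f) (hDa : ∀ s t, D (s + t) = D s + D t)
    (hDm : ∀ s t, D (s * t) = s * D t + t * D s)
    (hK : ∀ c : K, ψ (d (algebraMap K (AlgFun m) c)) = D (ψ (algebraMap K (AlgFun m) c)))
    (hX : ψ (d (algebraMap K[X] (AlgFun m) X)) = D (ψ (algebraMap K[X] (AlgFun m) X)))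
    (f : AlgFun m) : ψ (d f) = D (ψ f) := by
  -- The defect of commutation is a derivation along `ψ`. It vanishes on constants and on `x`, hence
  -- on `K[x]` and `K(x)`, and finally on the algebraic extension `A`.
  let Δ : AlgFun m →+ Series K := AddMonoidHom.mk' (fun f => ψ (d f) - D (ψ f)) (by
    intro f g
    simp only [hda, hDa, map_add]
    ring)
  have hΔ : ∀ f g, Δ (f * g) = ψ f * Δ g + ψ g * Δ f := by
    intro f g
    simp only [Δ, AddMonoidHom.mk'_apply, hdm, hDm, map_add, map_mul]
    ring
  have hpow : ∀ f (n : ℕ), Δ (f ^ n) = n * ψ f ^ (n - 1) * Δ f := by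
    intro f n
    induction n with
    | zero =>
      have := hΔ 1 1
      simp only [map_one, one_mul] at this
      simpa using this
    | succ n ih =>
      rw [pow_succ, hΔ, ih]
      cases n <;> simp [pow_succ]
      ring
  have hpoly : ∀ p : K[X], Δ (algebraMap K[X] (AlgFun m) p) = 0 := by
    intro p
    have hC : ∀ c : K, Δ (algebraMap K[X] (AlgFun m) (C c)) = 0 := by
      intro c
      have := hK c
      rw [IsScalarTower.algebraMap_apply K K[X] (AlgFun m)] at this
      exact sub_eq_zero.2 this
    have hX' : Δ (algebraMap K[X] (AlgFun m) X) = 0 := sub_eq_zero.2 hX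
    induction p using Polynomial.induction_on' with
    | add p q hp hq => rw [map_add, map_add, hp, hq, add_zero]
    | monomial n c =>
      rw [← C_mul_X_pow_eq_monomial, map_mul, hΔ, hC, map_pow, hpow, hX']
      simp
  have hrat : ∀ r : RatFunc K, Δ (algebraMap (RatFunc K) (AlgFun m) r) = 0 := by
    intro r
    have h1 : algebraMap (RatFunc K) (AlgFun m) r * algebraMap K[X] (AlgFun m) r.denom =
        algebraMap K[X] (AlgFun m) r.num := by
      rw [IsScalarTower.algebraMap_apply K[X] (RatFunc K) (AlgFun m),
        IsScalarTower.algebraMap_apply K[X] (RatFunc K) (AlgFun m), ← map_mul]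
      congr 1
      nth_rewrite 1 [← r.num_div_denom]
      exact div_mul_cancel₀ _
        ((map_ne_zero_iff _ (RatFunc.algebraMap_injective K)).2 r.denom_ne_zero)
    have h2 := congrArg Δ h1
    rw [hΔ, hpoly, hpoly, mul_zero, zero_add] at h2
    refine (mul_eq_zero.1 h2).resolve_left ?_
    exact (map_ne_zero_iff ψ ψ.injective).2 (algebraMap_polynomial_ne_zero m r.denom_ne_zero)
  have haeval : ∀ q : (RatFunc K)[X], Δ (aeval f q) = ψ (aeval f (derivative q)) * Δ f := by
    intro q
    induction q using Polynomial.induction_on' with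
    | add p q hp hq => simp only [map_add, hp, hq, add_mul]
    | monomial n c =>
      simp only [aeval_monomial, derivative_monomial, hΔ, hrat, hpow, map_mul, map_pow,
        map_natCast]
      ring
  -- Applying `Δ` to the minimal polynomial `μ_f` gives `0 = ψ(μ_f'(f)) * Δ f`, and `μ_f'(f) ≠ 0` by
  -- separability.
  have h0 : Δ f = 0 := by
    have h1 := haeval (minpoly (RatFunc K) f)
    rw [minpoly.aeval, map_zero] at h1
    refine (mul_eq_zero.1 h1.symm).resolve_left ?_
    refine (map_ne_zero_iff ψ ψ.injective).2 ?_
    exact (Algebra.IsSeparable.isSeparable (RatFunc K) f).aeval_derivative_ne_zero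
      (minpoly.aeval _ _)
  exact sub_eq_zero.1 h0

/-- The expansions of the elements of `A` as elements of the field of series. -/
def expansion (φ : AlgFun m →+* PuiseuxSeries (AlgebraicClosure K)) : AlgFun m →+* Series K :=
  (PuiseuxSeries (AlgebraicClosure K)).subtype.comp φ

theorem hasOrderAtLeast_iff {a : OnePoint (AlgebraicClosure K)} {β : ℚ} {f : AlgFun m} :
    HasOrderAtLeast m a β f ↔ ∀ φ, IsExpansionAt m a φ → OrdGE β (expansion φ f) := Iff.rfl

theorem IsExpansionAt.const {a : OnePoint (AlgebraicClosure K)}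
    {φ : AlgFun m →+* PuiseuxSeries (AlgebraicClosure K)} (h : IsExpansionAt m a φ) (c : K) :
    expansion φ (algebraMap K (AlgFun m) c) = HahnSeries.C (algebraMap K _ c) := h.1 c

theorem IsExpansionAt.polynomial {a : AlgebraicClosure K}
    {φ : AlgFun m →+* PuiseuxSeries (AlgebraicClosure K)}
    (h : IsExpansionAt m (OnePoint.some a) φ) (p : K[X]) :
    expansion φ (algebraMap K[X] (AlgFun m) p) =
      taylorAt a (p.map (algebraMap K (AlgebraicClosure K))) := by
  have : (expansion φ).comp (algebraMap K[X] (AlgFun m)) =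
      (taylorAt a).comp (mapRingHom (algebraMap K (AlgebraicClosure K))) := by
    refine Polynomial.ringHom_ext (fun c => ?_) ?_
    · have := h.const c
      rw [IsScalarTower.algebraMap_apply K K[X] (AlgFun m)] at this
      simpa [taylorAt_C] using this
    · have h2 : expansion φ (algebraMap K[X] (AlgFun m) X) =
          HahnSeries.C a + HahnSeries.single 1 1 := h.2
      simpa [taylorAt] using h2
  exact RingHom.congr_fun this p

theorem dx_const (c : K) : dx m (algebraMap K (AlgFun m) c) = 0 := by
  rw [IsScalarTower.algebraMap_apply K K[X] (AlgFun m), dx_algebraMap]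
  simp

theorem dx_X : dx m (algebraMap K[X] (AlgFun m) X) = 1 := by
  rw [dx_algebraMap]
  simp

theorem euler_C (c : AlgebraicClosure K) : euler (HahnSeries.C c : Series K) = 0 :=
  (twist_C 0 1 c).trans (by simp)

theorem euler_add (s t : Series K) : euler (s + t) = euler s + euler t := twist_add 0 1 s t

theorem euler_mul (s t : Series K) : euler (s * t) = s * euler t + t * euler s := twist_mul 0 1 s t

theorem euler_single (γ : ℚ) :
    euler (HahnSeries.single γ 1 : Series K) = HahnSeries.single γ (γ : AlgebraicClosure K) :=
  (twist_single 0 1 γ).trans (by simp)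

/-- At a finite place, `d/dx` is `d/dz = z⁻¹ (z d/dz)`. -/
theorem IsExpansionAt.dx_finite {a : AlgebraicClosure K}
    {φ : AlgFun m →+* PuiseuxSeries (AlgebraicClosure K)}
    (h : IsExpansionAt m (OnePoint.some a) φ) (f : AlgFun m) :
    expansion φ (dx m f) = HahnSeries.single (-1) 1 * euler (expansion φ f) := by
  refine comm_derivation (expansion φ) (dx m)
    (fun s => HahnSeries.single (-1) 1 * euler s) (dx_add m) (dx_mul m) ?_ ?_ ?_ ?_ f
  · intro s t
    simp only [euler_add, mul_add]
  · intro s t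
    simp only [euler_mul]
    ring
  · intro c
    rw [dx_const, h.const, euler_C, map_zero, mul_zero]
  · have h2 : expansion φ (algebraMap K[X] (AlgFun m) X) =
      HahnSeries.C a + HahnSeries.single 1 1 := h.2
    rw [dx_X, h2, euler_add, euler_C, euler_single]
    simp [HahnSeries.single_mul_single]

/-- At infinity, `d/dx` is `- z (z d/dz)`. -/
theorem IsExpansionAt.dx_infty {φ : AlgFun m →+* PuiseuxSeries (AlgebraicClosure K)}
    (h : IsExpansionAt m OnePoint.infty φ) (f : AlgFun m) :
    expansion φ (dx m f) = - (HahnSeries.single 1 1 * euler (expansion φ f)) := by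
  refine comm_derivation (expansion φ) (dx m)
    (fun s => - (HahnSeries.single 1 1 * euler s)) (dx_add m) (dx_mul m) ?_ ?_ ?_ ?_ f
  · intro s t
    simp only [euler_add, mul_add, neg_add]
  · intro s t
    simp only [euler_mul]
    ring
  · intro c
    rw [dx_const, h.const, euler_C, map_zero, mul_zero, neg_zero]
  · have h2 : expansion φ (algebraMap K[X] (AlgFun m) X) = HahnSeries.single (-1) 1 := h.2
    rw [dx_X, h2, euler_single]
    simp [HahnSeries.single_mul_single, ← HahnSeries.single_neg]

variable {a : OnePoint (AlgebraicClosure K)} {β γ : ℚ} {f g : AlgFun m}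

theorem HasOrderAtLeast.mono (h : HasOrderAtLeast m a β f) (hle : γ ≤ β) :
    HasOrderAtLeast m a γ f := fun φ hφ => OrdGE.mono (h φ hφ) hle

theorem HasOrderAtLeast.zero : HasOrderAtLeast m a β 0 := by
  rw [hasOrderAtLeast_iff]
  intro φ _
  rw [map_zero]
  exact ordGE_zero β

theorem HasOrderAtLeast.add (hf : HasOrderAtLeast m a β f) (hg : HasOrderAtLeast m a β g) :
    HasOrderAtLeast m a β (f + g) := by
  rw [hasOrderAtLeast_iff] at *
  intro φ hφ
  rw [map_add]
  exact (hf φ hφ).add (hg φ hφ)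

theorem HasOrderAtLeast.sub (hf : HasOrderAtLeast m a β f) (hg : HasOrderAtLeast m a β g) :
    HasOrderAtLeast m a β (f - g) := by
  rw [hasOrderAtLeast_iff] at *
  intro φ hφ
  rw [map_sub]
  exact (hf φ hφ).sub (hg φ hφ)

theorem HasOrderAtLeast.mul (hf : HasOrderAtLeast m a β f) (hg : HasOrderAtLeast m a γ g) :
    HasOrderAtLeast m a (β + γ) (f * g) := by
  rw [hasOrderAtLeast_iff] at *
  intro φ hφ
  rw [map_mul]
  exact (hf φ hφ).mul (hg φ hφ)

theorem hasOrderAtLeast_const (c : K) :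
    HasOrderAtLeast m a 0 (algebraMap K (AlgFun m) c) := by
  rw [hasOrderAtLeast_iff]
  intro φ hφ
  rw [hφ.const]
  exact ordGE_C _

theorem HasOrderAtLeast.const_smul (c : K) (hf : HasOrderAtLeast m a β f) :
    HasOrderAtLeast m a β (c • f) := by
  rw [Algebra.smul_def, ← zero_add β]
  exact (hasOrderAtLeast_const c).mul hf

theorem HasOrderAtLeast.sum {ι : Type*} {s : Finset ι} {F : ι → AlgFun m}
    (h : ∀ i ∈ s, HasOrderAtLeast m a β (F i)) : HasOrderAtLeast m a β (∑ i ∈ s, F i) := by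
  classical
  induction s using Finset.induction_on with
  | empty => exact HasOrderAtLeast.zero
  | insert i s hi ih =>
    rw [Finset.sum_insert hi]
    exact (h i (by simp)).add (ih fun j hj => h j (by simp [hj]))

theorem isGloballyIntegral_polynomial (p : K[X]) :
    IsGloballyIntegral m (algebraMap K[X] (AlgFun m) p) := by
  intro a
  rw [IsIntegralAt, hasOrderAtLeast_iff]
  intro φ hφ
  rw [hφ.polynomial]
  exact ordGE_taylorAt _ _

variable (m) in
/-- The ring of globally integral elements. -/
def globallyIntegralSubalgebra : Subalgebra K[X] (AlgFun m) where
  carrier := {f | IsGloballyIntegral m f}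
  mul_mem' hf hg a := by
    have := (hf a).mul (hg a)
    rwa [add_zero] at this
  add_mem' hf hg a := (hf a).add (hg a)
  algebraMap_mem' p := isGloballyIntegral_polynomial p

variable (m) in
/-- The elements that are integral at infinity, as an algebra over `K`. -/
def integralAtInftySubalgebra : Subalgebra K (AlgFun m) where
  carrier := {f | IsIntegralAt m OnePoint.infty f}
  mul_mem' hf hg := by
    have := HasOrderAtLeast.mul hf hg
    rwa [add_zero] at this
  add_mem' hf hg := HasOrderAtLeast.add hf hg
  algebraMap_mem' c := hasOrderAtLeast_const c

/-- If `H'` has at most simple poles, then `H` has none. -/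
theorem isIntegralAt_of_dx {a : AlgebraicClosure K} {H : AlgFun m}
    (h : HasOrderAtLeast m (OnePoint.some a) (-1) (dx m H)) :
    IsIntegralAt m (OnePoint.some a) H := by
  rw [IsIntegralAt, hasOrderAtLeast_iff] at *
  intro φ hφ
  have := h φ hφ
  rw [hφ.dx_finite, ordGE_single_mul_iff] at this
  exact ordGE_of_euler (by norm_num) this

/-- If `F'` has a double root at infinity, then `F` is integral at infinity. -/
theorem isIntegralAt_infty_of_dx {F : AlgFun m} (h : HasDoubleRootAtInfinity m (dx m F)) :
    IsIntegralAt m OnePoint.infty F := by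
  rw [IsIntegralAt, hasOrderAtLeast_iff]
  intro φ hφ
  have := (hasOrderAtLeast_iff.1 h φ hφ).neg
  rw [hφ.dx_infty, neg_neg, ordGE_single_mul_iff] at this
  exact ordGE_of_euler (by norm_num) this

/-- The derivation `∂_t` does not lower the order at infinity. -/
theorem HasOrderAtLeast.dt {δ : Differential K} (h : HasOrderAtLeast m OnePoint.infty β f) :
    HasOrderAtLeast m OnePoint.infty β (dt m δ f) := by
  -- The coefficients of expansions lie in the algebraic closure, so `δ` has to be extended there.
  -- At infinity the parameter `1/x` is killed by `∂_t`, which is why the action is purely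
  -- coefficientwise (`l = 0`).
  obtain ⟨δ', hδ'⟩ := exists_derivation_extension (L := AlgebraicClosure K) δ.deriv
  rw [hasOrderAtLeast_iff] at *
  intro φ hφ
  have hcomm : expansion φ (AlgTelescoping.dt m δ f) = twist δ' 0 (expansion φ f) := by
    refine comm_derivation (expansion φ) (AlgTelescoping.dt m δ) (twist δ' 0) (dt_add m δ)
      (dt_mul m δ) (twist_add δ' 0) (twist_mul δ' 0) ?_ ?_ f
    · intro c
      rw [dt_const, hφ.const, hφ.const, twist_C, hδ']
    · have h2 : expansion φ (algebraMap K[X] (AlgFun m) X) =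
        HahnSeries.single (-1) 1 := hφ.2
      rw [dt_x, h2, twist_single]
      simp
  rw [hcomm]
  exact (h φ hφ).twist δ' 0

/-- Zeros of a polynomial can be split off from its expansion. -/
theorem IsExpansionAt.polynomial_of_root {a : AlgebraicClosure K}
    {φ : AlgFun m →+* PuiseuxSeries (AlgebraicClosure K)}
    (h : IsExpansionAt m (OnePoint.some a) φ) {p : K[X]}
    (hp : (p.map (algebraMap K (AlgebraicClosure K))).eval a = 0) :
    ∃ q : (AlgebraicClosure K)[X],
      p.map (algebraMap K (AlgebraicClosure K)) = (X - C a) * q ∧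
      expansion φ (algebraMap K[X] (AlgFun m) p) =
        HahnSeries.single 1 1 * taylorAt a q := by
  obtain ⟨q, hq⟩ := dvd_iff_isRoot.2 hp
  exact ⟨q, hq, by rw [h.polynomial, hq, taylorAt_X_sub_C_mul]⟩

theorem IsExpansionAt.orderTop_polynomial {a : AlgebraicClosure K}
    {φ : AlgFun m →+* PuiseuxSeries (AlgebraicClosure K)}
    (h : IsExpansionAt m (OnePoint.some a) φ) {p : K[X]}
    (hp : (p.map (algebraMap K (AlgebraicClosure K))).eval a ≠ 0) :
    (expansion φ (algebraMap K[X] (AlgFun m) p)).orderTop = 0 := by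
  rw [h.polynomial]
  exact orderTop_taylorAt hp

theorem IsExpansionAt.ordGE_polynomial {a : AlgebraicClosure K}
    {φ : AlgFun m →+* PuiseuxSeries (AlgebraicClosure K)}
    (h : IsExpansionAt m (OnePoint.some a) φ) (p : K[X]) :
    OrdGE 0 (expansion φ (algebraMap K[X] (AlgFun m) p)) :=
  isGloballyIntegral_polynomial p a φ h

/-- In characteristic zero squarefree means separable, so `v` stays squarefree over the algebraic
closure and `a` is a simple root. -/
theorem eval_ne_zero_of_squarefree {v : K[X]} (hv : Squarefree v) {a : AlgebraicClosure K}
    {q : (AlgebraicClosure K)[X]}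
    (hq : v.map (algebraMap K (AlgebraicClosure K)) = (X - C a) * q) : q.eval a ≠ 0 := by
  intro h0
  have hsep : (v.map (algebraMap K (AlgebraicClosure K))).Separable :=
    (PerfectField.separable_iff_squarefree.2 hv).map
  obtain ⟨r, hr⟩ := dvd_iff_isRoot.2 h0
  have hsq := hsep.squarefree
  rw [hq, hr, ← mul_assoc] at hsq
  exact not_isUnit_X_sub_C a (hsq _ (dvd_mul_right _ _))

/-- Elements with a squarefree denominator have at most simple poles. -/
theorem hasOrderAtLeast_of_squarefree_smul {d : K[X]} (hd : Squarefree d)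
    (h : IsGloballyIntegral m (d • f)) (a : AlgebraicClosure K) :
    HasOrderAtLeast m (OnePoint.some a) (-1) f := by
  rw [hasOrderAtLeast_iff]
  intro φ hφ
  have h1 : OrdGE 0 (expansion φ (d • f)) := h a φ hφ
  rw [Algebra.smul_def, map_mul] at h1
  by_cases hp : (d.map (algebraMap K (AlgebraicClosure K))).eval a = 0
  · obtain ⟨q, hq, hqe⟩ := hφ.polynomial_of_root hp
    rw [hqe, mul_assoc, ordGE_single_mul_iff, zero_sub] at h1
    exact h1.of_mul_left (orderTop_taylorAt (eval_ne_zero_of_squarefree hd hq))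
  · exact (h1.of_mul_left (hφ.orderTop_polynomial hp)).mono (by norm_num)

/-- Multiple factors of a denominator of the derivative of an integral element cancel. -/
theorem isGloballyIntegral_smul_dx {p q : K[X]} {w : AlgFun m} (hw : IsGloballyIntegral m w)
    (h : IsGloballyIntegral m ((p * p * q) • dx m w)) :
    IsGloballyIntegral m ((p * q) • dx m w) := by
  intro a
  rw [IsIntegralAt, hasOrderAtLeast_iff]
  intro φ hφ
  have h1 : OrdGE 0 (expansion φ ((p * p * q) • dx m w)) := h a φ hφ
  by_cases hp : (p.map (algebraMap K (AlgebraicClosure K))).eval a = 0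
  · obtain ⟨r, -, hr⟩ := hφ.polynomial_of_root hp
    -- The zero of the one remaining factor `p` at `a` already cancels the `z⁻¹` in `d/dx = z⁻¹ (z
    -- d/dz)`, and the Euler operator preserves integrality.
    have h2 : expansion φ ((p * q) • dx m w) =
        taylorAt a r * (expansion φ (algebraMap K[X] (AlgFun m) q) * euler (expansion φ w)) := by
      rw [Algebra.smul_def, map_mul, map_mul, map_mul, hr, hφ.dx_finite]
      have h3 : (HahnSeries.single 1 1 : Series K) * HahnSeries.single (-1) 1 = 1 := by
        rw [HahnSeries.single_mul_single]
        simp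
      linear_combination (taylorAt a r * expansion φ (algebraMap K[X] (AlgFun m) q) *
        euler (expansion φ w)) * h3
    rw [h2]
    exact (ordGE_taylorAt a r).mul_left
      ((hφ.ordGE_polynomial q).mul_left (OrdGE.euler (hw a φ hφ)))
  · rw [mul_assoc, mul_smul, Algebra.smul_def, map_mul] at h1
    exact h1.of_mul_left (hφ.orderTop_polynomial hp)

/-- The local computation behind the solvability of the linear systems of Hermite reduction. -/
theorem isGloballyIntegral_div_of_hermite {u v : K[X]} (hv : Squarefree v) (huv : IsCoprime u v)
    {μ : ℕ} (hμ : 1 < μ) {w w' : AlgFun m} (hw : IsGloballyIntegral m w)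
    (hw' : IsGloballyIntegral m w')
    (h : (u * v) • dx m w - ((μ - 1 : ℕ) * u * derivative v : K[X]) • w = v • w') :
    IsGloballyIntegral m ((algebraMap K[X] (AlgFun m) v)⁻¹ * w) := by
  intro a
  rw [IsIntegralAt, hasOrderAtLeast_iff]
  intro φ hφ
  have hw0 : OrdGE 0 (expansion φ w) := hw a φ hφ
  have hv0 := algebraMap_polynomial_ne_zero m hv.ne_zero
  have hcancel : expansion φ (algebraMap K[X] (AlgFun m) v) *
      expansion φ ((algebraMap K[X] (AlgFun m) v)⁻¹ * w) = expansion φ w := by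
    rw [← map_mul, mul_inv_cancel_left₀ hv0]
  by_cases hp : (v.map (algebraMap K (AlgebraicClosure K))).eval a = 0
  · obtain ⟨q, hq, hqe⟩ := hφ.polynomial_of_root hp
    have hq0 := eval_ne_zero_of_squarefree hv hq
    rw [hqe, mul_assoc] at hcancel
    have hu : (u.map (algebraMap K (AlgebraicClosure K))).eval a ≠ 0 := by
      obtain ⟨r, s, hrs⟩ := huv
      intro h0
      have := congrArg (fun p => (p.map (algebraMap K (AlgebraicClosure K))).eval a) hrs
      simp [h0, hp] at this
    -- From `v = (x - a) q` it follows that `v' ≡ q` modulo `z`.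
    have hdv : expansion φ (algebraMap K[X] (AlgFun m) (derivative v)) =
        taylorAt a q + HahnSeries.single 1 1 * taylorAt a (derivative q) := by
      rw [hφ.polynomial, ← derivative_map, hq, ← taylorAt_X_sub_C_mul, ← map_add]
      congr 1
      simp [derivative_mul]
    have h1 := congrArg (expansion φ) h
    simp only [Algebra.smul_def, map_sub, map_mul, map_natCast, hdv, hqe, hφ.dx_finite] at h1
    have h3 : (HahnSeries.single 1 1 : Series K) * HahnSeries.single (-1) 1 = 1 := by
      rw [HahnSeries.single_mul_single]
      simp
    -- Modulo `z`, the hypothesis says that `u q (z w' - (μ - 1) w)` vanishes; `u` and `q` have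
    -- order `0` at `a` and can be cancelled.
    have h4 : expansion φ (algebraMap K[X] (AlgFun m) u) * (taylorAt a q *
        (euler (expansion φ w) - HahnSeries.C (((μ - 1 : ℕ) : ℚ) : AlgebraicClosure K) *
          expansion φ w)) = HahnSeries.single 1 1 *
          (taylorAt a q * expansion φ w' + ((μ - 1 : ℕ) : Series K) *
            (expansion φ (algebraMap K[X] (AlgFun m) u) * (taylorAt a (derivative q) *
              expansion φ w))) := by
      rw [Rat.cast_natCast, map_natCast]
      linear_combination h1 - (expansion φ (algebraMap K[X] (AlgFun m) u) * taylorAt a q *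
        euler (expansion φ w)) * h3
    have hn : OrdGE 0 ((μ - 1 : ℕ) : Series K) := by
      have := ordGE_C ((μ - 1 : ℕ) : AlgebraicClosure K)
      rwa [map_natCast] at this
    have h5 : OrdGE 1 (euler (expansion φ w) -
        HahnSeries.C (((μ - 1 : ℕ) : ℚ) : AlgebraicClosure K) * expansion φ w) := by
      refine OrdGE.of_mul_left (orderTop_taylorAt hq0)
        (OrdGE.of_mul_left (hφ.orderTop_polynomial hu) ?_)
      rw [h4, ordGE_single_mul_iff, sub_self]
      exact ((ordGE_taylorAt a q).mul_left (hw' a φ hφ)).add (hn.mul_left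
        ((hφ.ordGE_polynomial u).mul_left ((ordGE_taylorAt a _).mul_left hw0)))
    -- Since `μ - 1 ≥ 1`, no exponent below `1` is annihilated by `z d/dz - (μ - 1)`. So `w` has
    -- order at least `1`, which is the order of `v` at its simple root `a`.
    have h6 : OrdGE 1 (expansion φ w) := by
      refine ordGE_of_euler_sub _ ?_ h5
      exact_mod_cast (by omega : 1 ≤ μ - 1)
    rw [← hcancel, ordGE_single_mul_iff, sub_self] at h6
    exact h6.of_mul_left (orderTop_taylorAt hq0)
  · rw [← hcancel] at hw0
    exact hw0.of_mul_left (hφ.orderTop_polynomial hp)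

end Expansions

/-! ### Degrees of rational functions. -/

section Degree

variable {K : Type*} [Field K]

/-- The degree of the rational function `f` is at most `n`. -/
def DegLE (n : ℤ) (f : RatFunc K) : Prop := f = 0 ∨ f.intDegree ≤ n

theorem degLE_zero (n : ℤ) : DegLE n (0 : RatFunc K) := Or.inl rfl

theorem exists_degLE (f : RatFunc K) : ∃ n, DegLE n f := ⟨_, Or.inr le_rfl⟩

theorem DegLE.mono {n k : ℤ} {f : RatFunc K} (h : DegLE n f) (hle : n ≤ k) : DegLE k f :=
  h.imp_right fun h => h.trans hle

theorem DegLE.add {n : ℤ} {f g : RatFunc K} (hf : DegLE n f) (hg : DegLE n g) :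
    DegLE n (f + g) := by
  by_cases hf0 : f = 0
  · simpa [hf0] using hg
  by_cases hg0 : g = 0
  · simpa [hg0] using hf
  by_cases hfg : f + g = 0
  · exact Or.inl hfg
  · exact Or.inr ((RatFunc.intDegree_add_le hg0 hfg).trans
      (max_le (hf.resolve_left hf0) (hg.resolve_left hg0)))

theorem DegLE.neg {n : ℤ} {f : RatFunc K} (hf : DegLE n f) : DegLE n (-f) := by
  refine hf.imp (fun h => by simp [h]) fun h => ?_
  rwa [RatFunc.intDegree_neg]

theorem DegLE.sub {n : ℤ} {f g : RatFunc K} (hf : DegLE n f) (hg : DegLE n g) :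
    DegLE n (f - g) := by
  rw [sub_eq_add_neg]
  exact hf.add hg.neg

theorem DegLE.mul {n k : ℤ} {f g : RatFunc K} (hf : DegLE n f) (hg : DegLE k g) :
    DegLE (n + k) (f * g) := by
  by_cases hf0 : f = 0
  · exact Or.inl (by simp [hf0])
  by_cases hg0 : g = 0
  · exact Or.inl (by simp [hg0])
  refine Or.inr ?_
  rw [RatFunc.intDegree_mul hf0 hg0]
  exact add_le_add (hf.resolve_left hf0) (hg.resolve_left hg0)

theorem DegLE.sum {ι : Type*} {s : Finset ι} {n : ℤ} {F : ι → RatFunc K}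
    (h : ∀ i ∈ s, DegLE n (F i)) : DegLE n (∑ i ∈ s, F i) := by
  classical
  induction s using Finset.induction_on with
  | empty => exact degLE_zero n
  | insert i s hi ih =>
    rw [Finset.sum_insert hi]
    exact (h i (by simp)).add (ih fun j hj => h j (by simp [hj]))

theorem degLE_polynomial_iff {n : ℤ} {p : K[X]} :
    DegLE n (algebraMap K[X] (RatFunc K) p) ↔ p = 0 ∨ (p.natDegree : ℤ) ≤ n := by
  rw [DegLE, map_eq_zero_iff _ (RatFunc.algebraMap_injective K), RatFunc.intDegree_polynomial]

theorem degLE_div {n : ℤ} {p q : K[X]} (hq : q ≠ 0)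
    (h : p = 0 ∨ (p.natDegree : ℤ) ≤ q.natDegree + n) :
    DegLE n (algebraMap K[X] (RatFunc K) p / algebraMap K[X] (RatFunc K) q) := by
  by_cases hp : p = 0
  · exact Or.inl (by simp [hp])
  refine Or.inr ?_
  have hq' := (map_ne_zero_iff _ (RatFunc.algebraMap_injective K)).2 hq
  have hp' := (map_ne_zero_iff _ (RatFunc.algebraMap_injective K)).2 hp
  rw [div_eq_mul_inv, RatFunc.intDegree_mul hp' (inv_ne_zero hq'), RatFunc.intDegree_inv,
    RatFunc.intDegree_polynomial, RatFunc.intDegree_polynomial]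
  have := h.resolve_left hp
  omega

theorem mem_ratFuncAtInfinity {f : RatFunc K} : f ∈ RatFuncAtInfinity K ↔ DegLE 0 f := by
  constructor
  · rintro ⟨p, q, hq, hpq, rfl⟩
    refine degLE_div hq (Or.inr ?_)
    have := natDegree_le_natDegree hpq
    omega
  · intro h
    refine ⟨f.num, f.denom, f.denom_ne_zero, ?_, f.num_div_denom.symm⟩
    rcases h with rfl | h
    · simp
    · rw [RatFunc.intDegree] at h
      refine degree_le_of_natDegree_le ?_ |>.trans_eq (degree_eq_natDegree f.denom_ne_zero).symm
      omega

/-- The bound is not sharp, as differentiation lowers the degree, but only boundedness is needed. -/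
theorem DegLE.deriv {n : ℤ} {f : RatFunc K} (hf : DegLE n f) :
    DegLE n ((differentialVar K).deriv f) := by
  have hd := f.denom_ne_zero
  have h : (differentialVar K).deriv f = algebraMap K[X] (RatFunc K)
      (derivative f.num * f.denom - f.num * derivative f.denom) /
        algebraMap K[X] (RatFunc K) (f.denom ^ 2) := by
    rw [map_pow]
    rfl
  rw [h]
  rcases hf with rfl | hf
  · simp [degLE_zero]
  refine degLE_div (pow_ne_zero 2 hd) (Or.inr ?_)
  rw [RatFunc.intDegree] at hf
  have h1 : (derivative f.num * f.denom - f.num * derivative f.denom).natDegree ≤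
      f.num.natDegree + f.denom.natDegree := by
    refine (natDegree_sub_le _ _).trans (max_le ?_ ?_)
    · exact natDegree_mul_le.trans
        (Nat.add_le_add_right ((natDegree_derivative_le _).trans (Nat.sub_le _ _)) _)
    · exact natDegree_mul_le.trans
        (Nat.add_le_add_left ((natDegree_derivative_le _).trans (Nat.sub_le _ _)) _)
  rw [natDegree_pow]
  push_cast
  omega

end Degree

/-! ### Coordinates with respect to an integral basis; integrability and uniqueness of remainders.
-/

section Basis

variable {K : Type*} [Field K] [CharZero K] {m : K[X][X]} [IsDefiningPolynomial m]
  {W : Fin m.natDegree → AlgFun m}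

theorem finrank_algFun : Module.finrank (RatFunc K) (AlgFun m) = m.natDegree := by
  rw [(AdjoinRoot.powerBasis
    (Irreducible.ne_zero (Fact.out : Irreducible (overRatFunc m)))).finrank,
    AdjoinRoot.powerBasis_dim]
  exact natDegree_map_eq_of_injective (RatFunc.algebraMap_injective K) m

/-- An integral basis is a basis of `A` over `K(x)`. -/
def IsIntegralBasis.basis (hW : IsIntegralBasis m W) :
    Module.Basis (Fin m.natDegree) (RatFunc K) (AlgFun m) :=
  have : Nonempty (Fin m.natDegree) := ⟨⟨0, IsDefiningPolynomial.natDegree_pos⟩⟩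
  basisOfLinearIndependentOfCardEqFinrank
    ((LinearIndependent.iff_fractionRing K[X] (RatFunc K)).1 hW.1)
    (by rw [Fintype.card_fin, finrank_algFun])

theorem IsIntegralBasis.basis_apply (hW : IsIntegralBasis m W) (i : Fin m.natDegree) :
    hW.basis i = W i := by
  simp [IsIntegralBasis.basis]

/-- The coefficients of an element of `A` with respect to an integral basis. -/
def IsIntegralBasis.coeff (hW : IsIntegralBasis m W) (i : Fin m.natDegree) :
    AlgFun m →ₗ[RatFunc K] RatFunc K := hW.basis.coord i

theorem IsIntegralBasis.sum_coeff (hW : IsIntegralBasis m W) (f : AlgFun m) :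
    ∑ i, hW.coeff i f • W i = f := by
  have := hW.basis.sum_repr f
  simp only [hW.basis_apply] at this
  exact this

theorem IsIntegralBasis.coeff_sum (hW : IsIntegralBasis m W) (c : Fin m.natDegree → RatFunc K)
    (i : Fin m.natDegree) : hW.coeff i (∑ j, c j • W j) = c i := by
  have := congrFun (hW.basis.repr_sum_self c) i
  simp only [hW.basis_apply] at this
  exact this

theorem IsIntegralBasis.ext (hW : IsIntegralBasis m W) {f g : AlgFun m}
    (h : ∀ i, hW.coeff i f = hW.coeff i g) : f = g := by
  rw [← hW.sum_coeff f, ← hW.sum_coeff g]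
  simp only [h]

theorem sum_polynomial_smul (c : Fin m.natDegree → K[X]) :
    ∑ j, c j • W j = ∑ j, algebraMap K[X] (RatFunc K) (c j) • W j := by
  simp only [algebraMap_smul]

theorem IsIntegralBasis.isGloballyIntegral_sum (hW : IsIntegralBasis m W)
    (c : Fin m.natDegree → K[X]) : IsGloballyIntegral m (∑ j, c j • W j) :=
  (hW.2 _).1 (Submodule.mem_span_range_iff_exists_fun _ |>.2 ⟨c, rfl⟩)

theorem IsIntegralBasis.isGloballyIntegral (hW : IsIntegralBasis m W) (i : Fin m.natDegree) :
    IsGloballyIntegral m (W i) :=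
  (hW.2 _).1 (Submodule.subset_span ⟨i, rfl⟩)

theorem IsIntegralBasis.exists_sum (hW : IsIntegralBasis m W) {f : AlgFun m}
    (hf : IsGloballyIntegral m f) : ∃ c : Fin m.natDegree → K[X], ∑ j, c j • W j = f :=
  (Submodule.mem_span_range_iff_exists_fun _).1 ((hW.2 f).2 hf)

theorem IsIntegralBasis.isGloballyIntegral_iff (hW : IsIntegralBasis m W) {f : AlgFun m} :
    IsGloballyIntegral m f ↔ ∀ i, ∃ p : K[X], hW.coeff i f = algebraMap K[X] (RatFunc K) p := by
  constructor
  · intro hf i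
    obtain ⟨c, rfl⟩ := hW.exists_sum hf
    exact ⟨c i, by rw [sum_polynomial_smul, hW.coeff_sum]⟩
  · intro h
    choose c hc using h
    have := hW.isGloballyIntegral_sum c
    simpa only [sum_polynomial_smul, ← hc, hW.sum_coeff] using this

theorem IsIntegralBasis.coeff_combination (hW : IsIntegralBasis m W) (D : K[X])
    (F : Fin m.natDegree → K[X]) (i : Fin m.natDegree) :
    hW.coeff i (combination m W D F) =
      algebraMap K[X] (RatFunc K) (F i) / algebraMap K[X] (RatFunc K) D :=
  hW.coeff_sum _ i

theorem smul_combination {D : K[X]} (hD : D ≠ 0) (F : Fin m.natDegree → K[X]) :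
    D • combination m W D F = ∑ i, F i • W i := by
  rw [combination, Finset.smul_sum]
  refine Finset.sum_congr rfl fun i _ => ?_
  rw [← algebraMap_smul (RatFunc K) D, smul_smul, mul_div_cancel₀, algebraMap_smul]
  exact (map_ne_zero_iff _ (RatFunc.algebraMap_injective K)).2 hD

/-- Integrality at infinity is a bound on the degrees of the coefficients with respect to an
integral basis that is normal at infinity. -/
theorem IsNormalAtInfinity.exists_degree_bound (hN : IsNormalAtInfinity m W)
    (hW : IsIntegralBasis m W) :
    ∃ τ : Fin m.natDegree → ℤ, ∀ f : AlgFun m,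
      IsIntegralAt m OnePoint.infty f ↔ ∀ i, DegLE (τ i) (hW.coeff i f) := by
  obtain ⟨r, hr, hspan⟩ := hN
  have hr0 : ∀ i, r i ≠ 0 := by
    intro i h0
    refine hr.ne_zero i ?_
    simp [h0]
  -- The coordinate of `f` at `r_i ω_i` is its coefficient at `ω_i` divided by `r_i`, and it lies in
  -- the ring at infinity exactly when its degree is at most `0`.
  refine ⟨fun i => (r i).intDegree, fun f => ?_⟩
  rw [← hspan, Submodule.mem_span_range_iff_exists_fun]
  constructor
  · rintro ⟨c, rfl⟩ i
    have h : ∑ j, c j • r j • W j = ∑ j, ((c j : RatFunc K) * r j) • W j := by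
      refine Finset.sum_congr rfl fun j _ => ?_
      rw [mul_smul]
      rfl
    rw [h, hW.coeff_sum]
    have := (mem_ratFuncAtInfinity.1 (c i).2).mul (Or.inr (le_refl (r i).intDegree))
    rwa [zero_add] at this
  · intro h
    refine ⟨fun i => ⟨hW.coeff i f * (r i)⁻¹, mem_ratFuncAtInfinity.2 ?_⟩, ?_⟩
    · have h2 : DegLE (-(r i).intDegree) (r i)⁻¹ := Or.inr (by rw [RatFunc.intDegree_inv])
      have := (h i).mul h2
      rwa [add_neg_cancel] at this
    · conv_rhs => rw [← hW.sum_coeff f]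
      refine Finset.sum_congr rfl fun j _ => ?_
      change (hW.coeff j f * (r j)⁻¹) • r j • W j = _
      rw [smul_smul, inv_mul_cancel_right₀ (hr0 j)]

variable (W) in
/-- The `K`-space of the elements `∑ p_i ω_i` with polynomials `p_i` of degree at most `N`. -/
def boundedSpan (N : ℕ) : Submodule K (AlgFun m) :=
  Submodule.span K (Set.range fun ij : Fin m.natDegree × Fin (N + 1) =>
    (X ^ (ij.2 : ℕ) : K[X]) • W ij.1)

instance (N : ℕ) : FiniteDimensional K (boundedSpan W N) :=
  FiniteDimensional.span_of_finite K (Set.finite_range _)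

theorem IsIntegralBasis.mem_boundedSpan (hW : IsIntegralBasis m W) {f : AlgFun m} {N : ℕ}
    (hf : IsGloballyIntegral m f) (h : ∀ i, DegLE N (hW.coeff i f)) : f ∈ boundedSpan W N := by
  obtain ⟨c, rfl⟩ := hW.exists_sum hf
  refine Submodule.sum_mem _ fun i _ => ?_
  have hi := h i
  rw [sum_polynomial_smul, hW.coeff_sum, degLE_polynomial_iff] at hi
  have hdeg : (c i).natDegree < N + 1 := by
    rcases hi with h0 | hi
    · simp [h0]
    · omega
  rw [(c i).as_sum_range' (N + 1) hdeg, Finset.sum_smul]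
  refine Submodule.sum_mem _ fun j hj => ?_
  rw [← smul_X_eq_monomial, smul_assoc]
  exact Submodule.smul_mem _ _
    (Submodule.subset_span ⟨(i, ⟨j, Finset.mem_range.1 hj⟩), rfl⟩)

theorem dx_const_smul (c : K) (f : AlgFun m) : dx m (c • f) = c • dx m f := by
  rw [Algebra.smul_def, dx_mul, dx_const, mul_zero, add_zero, Algebra.smul_def]

variable (m) in
/-- The derivation `f ↦ f'` as a linear map over `K`. -/
def dxLinear : AlgFun m →ₗ[K] AlgFun m where
  toFun := dx m
  map_add' := dx_add m
  map_smul' := dx_const_smul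

theorem dx_zero : dx m 0 = 0 := map_zero (dxLinear m)

theorem dx_sub (f g : AlgFun m) : dx m (f - g) = dx m f - dx m g := map_sub (dxLinear m) f g

/-- Elements that are algebraic over `K` are constants. -/
theorem dx_eq_zero_of_isIntegral {f : AlgFun m} (hf : IsIntegral K f) : dx m f = 0 := by
  have h1 := (Derivation.mk' (dxLinear m) (dx_mul m)).map_aeval (minpoly K f) f
  rw [minpoly.aeval, map_zero, smul_eq_mul] at h1
  refine (mul_eq_zero.1 h1.symm).resolve_left ?_
  exact (minpoly.irreducible hf).separable.aeval_derivative_ne_zero (minpoly.aeval _ _)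

/-- Elements without any poles are constants. -/
theorem dx_eq_zero_of_integral (hW : IsIntegralBasis m W) (hN : IsNormalAtInfinity m W)
    {f : AlgFun m} (hf : IsGloballyIntegral m f) (hf' : IsIntegralAt m OnePoint.infty f) :
    dx m f = 0 := by
  obtain ⟨τ, hτ⟩ := hN.exists_degree_bound hW
  -- Being a ring matters here: once `S` is finite dimensional over `K`, all its elements are
  -- algebraic over `K`.
  let S : Subalgebra K (AlgFun m) :=
    (globallyIntegralSubalgebra m).restrictScalars K ⊓ integralAtInftySubalgebra m
  obtain ⟨N, hN⟩ : ∃ N : ℕ, ∀ i, τ i ≤ N := by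
    obtain ⟨N, hN⟩ := (Set.finite_range τ).bddAbove
    exact ⟨N.toNat, fun i => (hN ⟨i, rfl⟩).trans (Int.self_le_toNat N)⟩
  have hS : Subalgebra.toSubmodule S ≤ boundedSpan W N := fun g hg =>
    hW.mem_boundedSpan hg.1 fun i => ((hτ g).1 hg.2 i).mono (hN i)
  have hfin : FiniteDimensional K (Subalgebra.toSubmodule S) :=
    Submodule.finiteDimensional_of_le hS
  exact dx_eq_zero_of_isIntegral
    (IsIntegral.of_mem_of_fg S (Module.Finite.iff_fg.1 hfin) f ⟨hf, hf'⟩)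

/-- If `h` has at most simple poles and `g` has proper coefficients, then `g' + h` can only be
integrable with a double root at infinity if `h` is zero. -/
theorem remainder_eq_zero (hW : IsIntegralBasis m W) (hN : IsNormalAtInfinity m W)
    {F g h : AlgFun m} (hF : HasDoubleRootAtInfinity m (dx m F)) (heq : dx m F = dx m g + h)
    (hg : ∀ i, DegLE (-1) (hW.coeff i g))
    (hh : ∀ a : AlgebraicClosure K, HasOrderAtLeast m (OnePoint.some a) (-1) h) : h = 0 := by
  obtain ⟨τ, hτ⟩ := hN.exists_degree_bound hW
  have hH : dx m (F - g) = h := by rw [dx_sub, heq, add_sub_cancel_left]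
  have hint : IsGloballyIntegral m (F - g) := fun a => isIntegralAt_of_dx (hH ▸ hh a)
  rw [← hH]
  refine dx_eq_zero_of_integral hW hN hint ((hτ _).2 fun i => ?_)
  have hFi := (hτ _).1 (isIntegralAt_infty_of_dx hF) i
  rw [map_sub]
  -- A proper fraction obeys the bound `τ i` if this is at least `-1`. Otherwise both coefficients
  -- have degree at most `-1`, and so does their difference, which is a polynomial because `F - g`
  -- is integral, hence zero.
  by_cases hi : -1 ≤ τ i
  · exact hFi.sub ((hg i).mono hi)
  · have h1 := (hFi.mono (not_le.1 hi).le).sub (hg i)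
    obtain ⟨p, hp⟩ := hW.isGloballyIntegral_iff.1 hint i
    rw [map_sub] at hp
    rw [hp, degLE_polynomial_iff] at h1
    rw [hp]
    exact degLE_polynomial_iff.2 (Or.inl (h1.resolve_right (by omega)))

/-- Decompositions `g' + h`, where `g` has proper coefficients and `h` has at most simple poles,
are unique. -/
theorem remainder_unique (hW : IsIntegralBasis m W) {g₁ g₂ h₁ h₂ : AlgFun m}
    (heq : dx m g₁ + h₁ = dx m g₂ + h₂)
    (hg₁ : ∀ i, DegLE (-1) (hW.coeff i g₁)) (hg₂ : ∀ i, DegLE (-1) (hW.coeff i g₂))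
    (hh₁ : ∀ a : AlgebraicClosure K, HasOrderAtLeast m (OnePoint.some a) (-1) h₁)
    (hh₂ : ∀ a : AlgebraicClosure K, HasOrderAtLeast m (OnePoint.some a) (-1) h₂) :
    h₁ = h₂ := by
  have hd : dx m (g₂ - g₁) = h₁ - h₂ := by
    rw [dx_sub]
    linear_combination -heq
  have hint : IsGloballyIntegral m (g₂ - g₁) := fun a =>
    isIntegralAt_of_dx (hd ▸ (hh₁ a).sub (hh₂ a))
  -- The place at infinity is not needed: the coefficients of the difference are both polynomials
  -- and proper fractions.
  have h0 : g₂ - g₁ = 0 := by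
    refine hW.ext fun i => ?_
    obtain ⟨p, hp⟩ := hW.isGloballyIntegral_iff.1 hint i
    have h1 := (hg₂ i).sub (hg₁ i)
    rw [← map_sub, hp, degLE_polynomial_iff] at h1
    rw [hp, h1.resolve_right (by omega), map_zero, map_zero]
  rw [h0, dx_zero] at hd
  exact (sub_eq_zero.1 hd.symm)

end Basis

/-! ### Shape of the outputs, and the criterion for integrability. -/

section HermiteOutput

variable {K : Type*} [Field K] [CharZero K] {m : K[X][X]} [IsDefiningPolynomial m]
  {W : Fin m.natDegree → AlgFun m}

/-- The integrated part of a Hermite reduction has proper coefficients. -/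
theorem HermiteSteps.degLE_coeff (hW : IsIntegralBasis m W) {D : K[X]}
    {F : Fin m.natDegree → K[X]} {g h : AlgFun m} (hs : HermiteSteps m W D F g h)
    (i : Fin m.natDegree) : DegLE (-1) (hW.coeff i g) := by
  induction hs with
  | done D F hD =>
    rw [map_zero]
    exact degLE_zero _
  | step u v μ F G H g h hμ hv hsq huv hdeg heq hrest ih =>
    rw [map_add, hW.coeff_combination]
    refine DegLE.add (degLE_div (pow_ne_zero _ hsq.ne_zero) ?_) ih
    by_cases hG : G i = 0
    · exact Or.inl hG
    · right
      have h1 := natDegree_lt_natDegree hG (hdeg i)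
      have h2 : v.natDegree ≤ (v ^ (μ - 1)).natDegree := by
        rw [natDegree_pow]
        exact Nat.le_mul_of_pos_left _ (by omega)
      omega

/-- The remainder of a Hermite reduction has a squarefree denominator. -/
theorem HermiteSteps.exists_squarefree {D : K[X]}
    {F : Fin m.natDegree → K[X]} {g h : AlgFun m} (hs : HermiteSteps m W D F g h) :
    ∃ (d : K[X]) (H : Fin m.natDegree → K[X]), Squarefree d ∧ d ∣ D ∧
      h = combination m W d H := by
  induction hs with
  | done D F hD => exact ⟨D, F, hD, dvd_rfl, rfl⟩
  | step u v μ F G H g h hμ hv hsq huv hdeg heq hrest ih =>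
    obtain ⟨d, H', hd, hdvd, rfl⟩ := ih
    exact ⟨d, H', hd, hdvd.trans (mul_dvd_mul_left _ (pow_dvd_pow _ (Nat.sub_le _ _))), rfl⟩

theorem HermiteSteps.hasOrderAtLeast (hW : IsIntegralBasis m W) {D : K[X]}
    {F : Fin m.natDegree → K[X]} {g h : AlgFun m} (hs : HermiteSteps m W D F g h)
    (a : AlgebraicClosure K) : HasOrderAtLeast m (OnePoint.some a) (-1) h := by
  obtain ⟨d, H, hd, -, rfl⟩ := hs.exists_squarefree
  refine hasOrderAtLeast_of_squarefree_smul hd ?_ a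
  rw [smul_combination hd.ne_zero]
  exact hW.isGloballyIntegral_sum H

theorem IsHermiteReduction.degLE_coeff (hW : IsIntegralBasis m W) {f g h : AlgFun m}
    (hr : IsHermiteReduction m W f g h) (i : Fin m.natDegree) : DegLE (-1) (hW.coeff i g) := by
  obtain ⟨e, D, F, -, -, -, -, hs⟩ := hr
  exact hs.degLE_coeff hW i

theorem IsHermiteReduction.hasOrderAtLeast (hW : IsIntegralBasis m W) {f g h : AlgFun m}
    (hr : IsHermiteReduction m W f g h) (a : AlgebraicClosure K) :
    HasOrderAtLeast m (OnePoint.some a) (-1) h := by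
  obtain ⟨e, D, F, -, -, -, -, hs⟩ := hr
  exact hs.hasOrderAtLeast hW a

/-- The remainder of the Hermite reduction of `f` decides the integrability of `f`. -/
theorem IsHermiteReduction.eq_zero_iff (hW : IsIntegralBasis m W) (hN : IsNormalAtInfinity m W)
    {f g h : AlgFun m} (hf : HasDoubleRootAtInfinity m f) (hr : IsHermiteReduction m W f g h) :
    h = 0 ↔ IsIntegrable m f := by
  constructor
  · rintro rfl
    exact ⟨g, by rw [hr.eq, add_zero]⟩
  · rintro ⟨F, rfl⟩
    exact remainder_eq_zero hW hN hf hr.eq (hr.degLE_coeff hW) (hr.hasOrderAtLeast hW)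

end HermiteOutput

/-! ### Common denominators and the squarefreeness of `e`. -/

section Denominators

variable {K : Type*} [Field K] [CharZero K] {m : K[X][X]} [IsDefiningPolynomial m]
  {W : Fin m.natDegree → AlgFun m}

theorem IsGloballyIntegral.smul {f : AlgFun m} (hf : IsGloballyIntegral m f) (p : K[X]) :
    IsGloballyIntegral m (p • f) :=
  (globallyIntegralSubalgebra m).smul_mem hf p

theorem IsGloballyIntegral.add {f g : AlgFun m} (hf : IsGloballyIntegral m f)
    (hg : IsGloballyIntegral m g) : IsGloballyIntegral m (f + g) :=
  (globallyIntegralSubalgebra m).add_mem hf hg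

theorem IsGloballyIntegral.sub {f g : AlgFun m} (hf : IsGloballyIntegral m f)
    (hg : IsGloballyIntegral m g) : IsGloballyIntegral m (f - g) :=
  (globallyIntegralSubalgebra m).sub_mem hf hg

theorem IsGloballyIntegral.sum {ι : Type*} {s : Finset ι} {F : ι → AlgFun m}
    (h : ∀ i ∈ s, IsGloballyIntegral m (F i)) : IsGloballyIntegral m (∑ i ∈ s, F i) :=
  (globallyIntegralSubalgebra m).sum_mem h

theorem IsGloballyIntegral.smul_of_dvd {p q : K[X]} {f : AlgFun m}
    (hf : IsGloballyIntegral m (p • f)) (h : p ∣ q) : IsGloballyIntegral m (q • f) := by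
  obtain ⟨r, rfl⟩ := h
  rw [mul_comm, mul_smul]
  exact hf.smul r

theorem IsIntegralBasis.exists_smul (hW : IsIntegralBasis m W) (f : AlgFun m) :
    ∃ q : K[X], q ≠ 0 ∧ IsGloballyIntegral m (q • f) := by
  obtain ⟨b, hb⟩ := IsLocalization.exist_integer_multiples_of_finite (nonZeroDivisors K[X])
    (fun i => hW.coeff i f)
  refine ⟨b, nonZeroDivisors.coe_ne_zero b, hW.isGloballyIntegral_iff.2 fun i => ?_⟩
  obtain ⟨p, hp⟩ := hb i
  refine ⟨p, ?_⟩
  rw [hp, ← algebraMap_smul (RatFunc K) (b : K[X]), map_smul, algebraMap_smul]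

theorem IsIntegralBasis.exists_common_smul (hW : IsIntegralBasis m W) {ι : Type*} [Fintype ι]
    (F : ι → AlgFun m) : ∃ q : K[X], q ≠ 0 ∧ ∀ i, IsGloballyIntegral m (q • F i) := by
  choose q hq hF using fun i => hW.exists_smul (F i)
  exact ⟨∏ i, q i, Finset.prod_ne_zero_iff.2 fun i _ => hq i,
    fun i => (hF i).smul_of_dvd (Finset.dvd_prod_of_mem q (Finset.mem_univ i))⟩

theorem dx_smul (p : K[X]) (f : AlgFun m) : dx m (p • f) = p • dx m f + derivative p • f := by
  rw [Algebra.smul_def, dx_mul, dx_algebraMap, Algebra.smul_def, Algebra.smul_def]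
  ring

theorem dx_sum_smul (c : Fin m.natDegree → K[X]) :
    dx m (∑ i, c i • W i) = ∑ i, c i • dx m (W i) + ∑ i, derivative (c i) • W i := by
  rw [← Finset.sum_add_distrib]
  refine (map_sum (dxLinear m) _ _).trans (Finset.sum_congr rfl fun i _ => dx_smul _ _)

theorem sum_smul_injective (hW : IsIntegralBasis m W) {c c' : Fin m.natDegree → K[X]}
    (h : ∑ i, c i • W i = ∑ i, c' i • W i) : c = c' := by
  funext i
  apply RatFunc.algebraMap_injective K
  rw [sum_polynomial_smul, sum_polynomial_smul] at h
  rw [← hW.coeff_sum (fun j => algebraMap K[X] (RatFunc K) (c j)) i, h, hW.coeff_sum]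

/-- The derivatives of the elements of an integral basis have a reduced common denominator. -/
theorem IsIntegralBasis.exists_derivativeDenominator (hW : IsIntegralBasis m W) :
    ∃ e, IsDerivativeDenominator m W e := by
  classical
  -- A common denominator of least degree is reduced, since a nonconstant common factor could be
  -- cancelled.
  let P : ℕ → Prop := fun n => ∃ e : K[X], e ≠ 0 ∧ e.natDegree = n ∧
    ∀ i, IsGloballyIntegral m (e • dx m (W i))
  have hP : ∃ n, P n := by
    obtain ⟨q, hq, h⟩ := hW.exists_common_smul fun i => dx m (W i)
    exact ⟨_, q, hq, rfl, h⟩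
  obtain ⟨e, he0, hen, he⟩ := Nat.find_spec hP
  choose M hM using fun i => hW.exists_sum (he i)
  refine ⟨e, M, fun i => (hM i).symm, ?_⟩
  rintro p ⟨e', rfl⟩ hp
  choose M' hM' using hp
  have hp0 : p ≠ 0 := left_ne_zero_of_mul he0
  have he' : e' ≠ 0 := right_ne_zero_of_mul he0
  have hmin : Nat.find hP ≤ e'.natDegree := by
    refine Nat.find_min' hP ⟨e', he', rfl, fun i => ?_⟩
    have h1 : p • (e' • dx m (W i)) = p • ∑ j, M' i j • W j := by
      rw [smul_smul, ← hM i, Finset.smul_sum]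
      exact Finset.sum_congr rfl fun j _ => by rw [hM' i j, mul_smul]
    rw [Algebra.smul_def, Algebra.smul_def p] at h1
    rw [mul_left_cancel₀ (algebraMap_polynomial_ne_zero m hp0) h1]
    exact hW.isGloballyIntegral_sum _
  rw [← hen, natDegree_mul hp0 he'] at hmin
  exact isUnit_iff_degree_eq_zero.2 (by
    rw [degree_eq_natDegree hp0]
    exact_mod_cast (by omega : p.natDegree = 0))

theorem IsDerivativeDenominator.isGloballyIntegral (hW : IsIntegralBasis m W) {e : K[X]}
    (he : IsDerivativeDenominator m W e) (i : Fin m.natDegree) :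
    IsGloballyIntegral m (e • dx m (W i)) := by
  obtain ⟨M, hM, -⟩ := he
  rw [hM]
  exact hW.isGloballyIntegral_sum _

/-- For `e = 0` independence forces all `M i j = 0`, and then `X` is a common factor. -/
theorem IsDerivativeDenominator.ne_zero (hW : IsIntegralBasis m W) {e : K[X]}
    (he : IsDerivativeDenominator m W e) : e ≠ 0 := by
  rintro rfl
  obtain ⟨M, hM, hu⟩ := he
  refine not_isUnit_X (hu X (dvd_zero _) fun i j => ?_)
  have h1 : ∑ j, M i j • W j = ∑ j, (0 : Fin m.natDegree → K[X]) j • W j := by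
    rw [← hM i]
    simp
  rw [sum_smul_injective hW h1]
  exact dvd_zero _

/-- The common denominator of the derivatives of the elements of an integral basis is
squarefree. -/
theorem IsDerivativeDenominator.squarefree (hW : IsIntegralBasis m W) {e : K[X]}
    (he : IsDerivativeDenominator m W e) : Squarefree e := by
  rintro p ⟨q, rfl⟩
  -- If `e = p² q`, then `p q` already clears the derivatives, so `p` divides `e` and every `M i j`
  -- and must be a unit.
  have hint := fun i =>
    isGloballyIntegral_smul_dx (hW.isGloballyIntegral i) (he.isGloballyIntegral hW i)
  choose N hN using fun i => hW.exists_sum (hint i)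
  obtain ⟨M, hM, hu⟩ := he
  refine hu p ⟨p * q, mul_assoc p p q⟩ fun i j => ⟨N i j, ?_⟩
  refine congrFun (sum_smul_injective hW (c := M i) (c' := fun j => p * N i j) ?_) j
  rw [← hM i, mul_assoc, mul_smul, ← hN i, Finset.smul_sum]
  exact Finset.sum_congr rfl fun j _ => by rw [mul_smul]

end Denominators

/-! ### Existence of Hermite reductions. -/

section Existence

variable {K : Type*} [Field K] [CharZero K] {m : K[X][X]} [IsDefiningPolynomial m]
  {W : Fin m.natDegree → AlgFun m}

/-- A square linear system that is injective modulo `v` is solvable modulo `v`. -/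
theorem exists_vecMul_add {ι : Type*} [Fintype ι] {v : K[X]} (hv : v ≠ 0)
    (S : Matrix ι ι K[X])
    (hS : ∀ c : ι → K[X], (∀ j, v ∣ Matrix.vecMul c S j) → ∀ i, v ∣ c i) (F : ι → K[X]) :
    ∃ G R : ι → K[X], (∀ i, (G i).degree < v.degree) ∧
      ∀ j, F j = Matrix.vecMul G S j + v * R j := by
  classical
  let π := AdjoinRoot.mk v
  have : FiniteDimensional K (AdjoinRoot v) := (AdjoinRoot.powerBasis hv).finite
  -- Over `K` the system is an endomorphism of a finite dimensional space, so injectivity gives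
  -- surjectivity even if `v` is reducible.
  let T : (ι → AdjoinRoot v) →ₗ[K] (ι → AdjoinRoot v) :=
    (Matrix.vecMulLinear (S.map π)).restrictScalars K
  have hT : ∀ (c : ι → K[X]) (j : ι), T (fun i => π (c i)) j = π (Matrix.vecMul c S j) :=
    fun c j => (RingHom.map_vecMul π S c j).symm
  have hinj : Function.Injective T := by
    rw [injective_iff_map_eq_zero]
    intro c hc
    choose c' hc' using fun i => AdjoinRoot.mk_surjective (g := v) (c i)
    obtain rfl : (fun i => π (c' i)) = c := funext hc'
    funext i
    refine AdjoinRoot.mk_eq_zero.2 (hS c' (fun j => AdjoinRoot.mk_eq_zero.1 ?_) i)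
    rw [← hT, hc]
    rfl
  obtain ⟨c, hc⟩ := LinearMap.surjective_of_injective hinj fun i => π (F i)
  choose c' hc' using fun i => AdjoinRoot.mk_surjective (g := v) (c i)
  have hG : (fun i => π (c' i % v)) = c := by
    funext i
    rw [← hc' i]
    refine AdjoinRoot.mk_eq_mk.2 ⟨-(c' i / v), ?_⟩
    linear_combination EuclideanDomain.mod_add_div (c' i) v
  have hR : ∀ j, v ∣ F j - Matrix.vecMul (fun i => c' i % v) S j := by
    intro j
    rw [← AdjoinRoot.mk_eq_mk]
    exact ((hT (fun i => c' i % v) j).symm.trans (by rw [hG, hc])).symm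
  choose R hR using hR
  exact ⟨fun i => c' i % v, R, fun i => EuclideanDomain.mod_lt _ hv,
    fun j => by rw [← hR j]; ring⟩

/-- A step of Hermite reduction is possible. -/
theorem exists_hermite_step (hW : IsIntegralBasis m W) {e u v : K[X]} {μ : ℕ}
    (he : IsDerivativeDenominator m W e) (hdvd : e ∣ u * v) (hv : Squarefree v)
    (huv : IsCoprime u v) (hu : u ≠ 0) (hμ : 1 < μ) (F : Fin m.natDegree → K[X]) :
    ∃ G H : Fin m.natDegree → K[X], (∀ i, (G i).degree < v.degree) ∧
      combination m W (u * v ^ μ) F =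
        dx m (combination m W (v ^ (μ - 1)) G) + combination m W (u * v ^ (μ - 1)) H := by
  obtain ⟨k, rfl⟩ : ∃ k, μ = k + 1 + 1 := ⟨μ - 2, by omega⟩
  choose N hN using fun i => hW.exists_sum ((he.isGloballyIntegral hW i).smul_of_dvd hdvd)
  -- For `w = ∑ c_i ω_i`, multiplying `(w / v^(μ-1))'` by `u v^μ` gives `u v w' - (μ - 1) u v' w`.
  -- Modulo `v` the terms with `c_i'` disappear, and `S` is the matrix of what remains.
  let S : Matrix (Fin m.natDegree) (Fin m.natDegree) K[X] :=
    Matrix.of N - ((k + 1 : ℕ) * u * derivative v : K[X]) • (1 : Matrix _ _ K[X])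
  have hcomb : ∀ c : Fin m.natDegree → K[X],
      (u * v) • dx m (∑ i, c i • W i) - ((k + 1 : ℕ) * u * derivative v : K[X]) •
        ∑ i, c i • W i =
      ∑ j, (Matrix.vecMul c S j + u * v * derivative (c j)) • W j := by
    intro c
    have h1 : ∑ i, (u * v) • c i • dx m (W i) = ∑ j, (Matrix.vecMul c (Matrix.of N) j) • W j := by
      simp only [Matrix.vecMul, dotProduct, Finset.sum_smul, Matrix.of_apply]
      rw [Finset.sum_comm]
      refine Finset.sum_congr rfl fun i _ => ?_
      rw [smul_comm, ← hN i, Finset.smul_sum]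
      exact Finset.sum_congr rfl fun j _ => by rw [mul_smul]
    simp only [mul_smul] at h1
    simp only [S, dx_sum_smul, smul_add, Finset.smul_sum, Matrix.vecMul_sub,
      Matrix.vecMul_smul, Matrix.vecMul_one, Pi.sub_apply, Pi.smul_apply, add_smul, sub_smul,
      Finset.sum_add_distrib, Finset.sum_sub_distrib, smul_eq_mul, mul_smul]
    rw [h1]
    abel
  obtain ⟨G, R, hG, hR⟩ := exists_vecMul_add hv.ne_zero S (by
    intro c hc i
    choose R hR using hc
    have h1 := isGloballyIntegral_div_of_hermite hv huv hμ (hW.isGloballyIntegral_sum c)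
      (hW.isGloballyIntegral_sum fun j => R j + u * derivative (c j)) (by
        rw [Nat.add_sub_cancel, hcomb, Finset.smul_sum]
        refine Finset.sum_congr rfl fun j _ => ?_
        rw [hR, smul_smul]
        congr 1
        ring)
    obtain ⟨b, hb⟩ := hW.exists_sum h1
    refine ⟨b i, congrFun (sum_smul_injective hW (c' := fun j => v * b j) ?_) i⟩
    simp only [mul_smul, ← Finset.smul_sum]
    rw [hb, Algebra.smul_def, mul_inv_cancel_left₀ (algebraMap_polynomial_ne_zero m hv.ne_zero)])
    F
  -- The terms `u v G_j'` that were dropped modulo `v` are returned here to the next numerator.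
  refine ⟨G, fun j => R j - u * derivative (G j), hG, ?_⟩
  rw [Nat.add_sub_cancel]
  have hv0 : v ^ (k + 1) ≠ 0 := pow_ne_zero _ hv.ne_zero
  have hD : u * v ^ (k + 1 + 1) ≠ 0 := mul_ne_zero hu (pow_ne_zero _ hv.ne_zero)
  have hy := smul_combination (W := W) hv0 G
  set y := combination m W (v ^ (k + 1)) G with hydef
  have hH := smul_combination (W := W) (mul_ne_zero hu hv0) fun j => R j - u * derivative (G j)
  set z := combination m W (u * v ^ (k + 1)) fun j => R j - u * derivative (G j) with hzdef
  have hdy : (u * v ^ (k + 1 + 1)) • dx m y =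
      ∑ j, (Matrix.vecMul G S j + u * v * derivative (G j)) • W j := by
    rw [← hcomb G, ← hy, dx_smul, derivative_pow]
    simp only [Algebra.smul_def, map_mul, map_pow, map_natCast, Nat.add_sub_cancel,
      Nat.cast_add, map_add, map_one, Nat.cast_one]
    ring
  apply mul_left_cancel₀ (algebraMap_polynomial_ne_zero m hD)
  rw [← Algebra.smul_def, ← Algebra.smul_def, smul_add, smul_combination hD, hdy,
    show u * v ^ (k + 1 + 1) = v * (u * v ^ (k + 1)) by ring, mul_smul v, hH, Finset.smul_sum,
    ← Finset.sum_add_distrib]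
  refine Finset.sum_congr rfl fun j _ => ?_
  rw [smul_smul, ← add_smul, hR j]
  congr 1
  ring

/-- Hermite reduction can be carried out until the denominator is squarefree. -/
theorem exists_hermiteSteps (hW : IsIntegralBasis m W) {e : K[X]}
    (he : IsDerivativeDenominator m W e) (D : K[X]) (hD : D ≠ 0) (hdvd : e ∣ D)
    (F : Fin m.natDegree → K[X]) : ∃ g h, HermiteSteps m W D F g h := by
  induction hn : D.natDegree using Nat.strong_induction_on generalizing D F with
  | _ n ih =>
  by_cases hsq : Squarefree D
  · exact ⟨_, _, .done D F hsq⟩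
  rw [squarefree_iff_irreducible_sq_not_dvd_of_ne_zero hD] at hsq
  push Not at hsq
  obtain ⟨v, hv, hvD⟩ := hsq
  -- Taking an irreducible `v` with its full multiplicity makes `v` squarefree and coprime to `u`.
  obtain ⟨u, μ, rfl, hvu⟩ : ∃ (u : K[X]) (μ : ℕ), D = u * v ^ μ ∧ ¬ v ∣ u := by
    obtain ⟨u, hDu, hvu⟩ :=
      (FiniteMultiplicity.of_not_isUnit hv.not_isUnit hD).exists_eq_pow_mul_and_not_dvd
    exact ⟨u, _, hDu.trans (mul_comm _ _), hvu⟩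
  have hu : u ≠ 0 := left_ne_zero_of_mul hD
  have huv : IsCoprime u v := ((hv.coprime_iff_not_dvd).2 hvu).symm
  have hμ : 1 < μ := by
    by_contra hle
    rcases Nat.le_one_iff_eq_zero_or_eq_one.1 (not_lt.1 hle) with h0 | h0 <;> rw [h0] at hvD
    · rw [pow_zero, mul_one] at hvD
      exact hvu ((dvd_mul_right v v).trans hvD)
    · rw [pow_one] at hvD
      exact hvu ((mul_dvd_mul_iff_right hv.ne_zero).1 hvD)
  -- Squarefreeness of `e` reduces its divisibility to `u v`. As `μ - 1 ≥ 1`, `e` also divides the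
  -- next denominator, so the recursion can continue.
  have hdvd' : e ∣ u * v := by
    refine ((he.squarefree hW).dvd_pow_iff_dvd (by omega : μ ≠ 0)).1 (hdvd.trans ?_)
    rw [mul_pow]
    exact mul_dvd_mul_right (dvd_pow_self u (by omega)) _
  obtain ⟨G, H, hdeg, heq⟩ := exists_hermite_step hW he hdvd' hv.squarefree huv hu hμ F
  have hlt : (u * v ^ (μ - 1)).natDegree < n := by
    rw [← hn, natDegree_mul hu (pow_ne_zero _ hv.ne_zero), natDegree_mul hu
      (pow_ne_zero _ hv.ne_zero), natDegree_pow, natDegree_pow]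
    exact Nat.add_lt_add_left (Nat.mul_lt_mul_of_pos_right (by omega) hv.natDegree_pos) _
  obtain ⟨g, h, hs⟩ := ih _ hlt (u * v ^ (μ - 1)) (mul_ne_zero hu (pow_ne_zero _ hv.ne_zero))
    (hdvd'.trans (mul_dvd_mul_left u (dvd_pow_self v (by omega)))) H rfl
  exact ⟨_, _, .step u v μ F G H g h hμ hv.not_isUnit hv.squarefree huv hdeg heq hs⟩

theorem IsIntegralBasis.exists_combination (hW : IsIntegralBasis m W) {f : AlgFun m} {D : K[X]}
    (hD : D ≠ 0) (hf : IsGloballyIntegral m (D • f)) : ∃ F, f = combination m W D F := by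
  obtain ⟨F, hF⟩ := hW.exists_sum hf
  refine ⟨F, ?_⟩
  apply mul_left_cancel₀ (algebraMap_polynomial_ne_zero m hD)
  rw [← Algebra.smul_def, ← Algebra.smul_def, smul_combination hD, hF]

/-- Every element with denominator `Q ^ (k + 1)` has a Hermite reduction whose remainder has the
denominator `Q`. -/
theorem exists_isHermiteReduction (hW : IsIntegralBasis m W) {e Q : K[X]}
    (he : IsDerivativeDenominator m W e) (hQ : Q ≠ 0) (hdvd : e ∣ Q) {f : AlgFun m} {k : ℕ}
    (hf : IsGloballyIntegral m (Q ^ (k + 1) • f)) :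
    ∃ g h, IsHermiteReduction m W f g h ∧ IsGloballyIntegral m (Q • h) := by
  have hD : Q ^ (k + 1) ≠ 0 := pow_ne_zero _ hQ
  have hdvd' : e ∣ Q ^ (k + 1) := hdvd.trans (dvd_pow_self Q (Nat.succ_ne_zero k))
  obtain ⟨F, rfl⟩ := hW.exists_combination hD hf
  obtain ⟨g, h, hs⟩ := exists_hermiteSteps hW he _ hD hdvd' F
  refine ⟨g, h, ⟨e, _, F, he, hD, hdvd', rfl, hs⟩, ?_⟩
  obtain ⟨d, H, hd, hdQ, rfl⟩ := hs.exists_squarefree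
  refine IsGloballyIntegral.smul_of_dvd (p := d) ?_
    ((hd.dvd_pow_iff_dvd (Nat.succ_ne_zero k)).1 hdQ)
  rw [smul_combination hd.ne_zero]
  exact hW.isGloballyIntegral_sum H

end Existence

/-! ### Growth of denominators under `∂_t`. -/

section DenominatorsUnderDt

variable {K : Type*} [Field K] [CharZero K] {m : K[X][X]} [IsDefiningPolynomial m]
  {W : Fin m.natDegree → AlgFun m} (δ : Differential K)

theorem exists_dt_polynomial (p : K[X]) :
    ∃ p' : K[X], dt m δ (algebraMap K[X] (AlgFun m) p) = algebraMap K[X] (AlgFun m) p' := by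
  refine ⟨@Differential.mapCoeffs K _ δ p, ?_⟩
  rw [IsScalarTower.algebraMap_apply K[X] (RatFunc K) (AlgFun m),
    IsScalarTower.algebraMap_apply K[X] (RatFunc K) (AlgFun m), dt,
    differentialAdjoinRoot_algebraMap, ratFuncDifferential_algebraMap]

variable (m) in
/-- The derivation `∂_t` as an additive map. -/
def dtHom : AlgFun m →+ AlgFun m := AddMonoidHom.mk' (dt m δ) (dt_add m δ)

/-- The power rule multiplied by `f`, which avoids the exponent `n - 1`. -/
theorem mul_dt_pow (f : AlgFun m) (n : ℕ) : f * dt m δ (f ^ n) = n * f ^ n * dt m δ f := by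
  induction n with
  | zero =>
    have h := dt_mul m δ 1 1
    simp only [one_mul] at h
    have h0 : dt m δ 1 = 0 := by linear_combination -h
    simp [h0]
  | succ n ih =>
    rw [pow_succ, dt_mul]
    push_cast
    linear_combination f * ih

/-- A common denominator of the `∂_t ω_i` is one of the `∂_t w` with integral `w`. -/
theorem isGloballyIntegral_smul_dt (hW : IsIntegralBasis m W) {Q : K[X]}
    (hQ : ∀ i, IsGloballyIntegral m (Q • dt m δ (W i))) {w : AlgFun m}
    (hw : IsGloballyIntegral m w) : IsGloballyIntegral m (Q • dt m δ w) := by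
  obtain ⟨c, rfl⟩ := hW.exists_sum hw
  have h := map_sum (dtHom m δ) (fun i => c i • W i) Finset.univ
  change dt m δ _ = ∑ i, dt m δ _ at h
  rw [h, Finset.smul_sum]
  refine IsGloballyIntegral.sum fun i _ => ?_
  obtain ⟨p, hp⟩ := exists_dt_polynomial (m := m) δ (c i)
  have h2 : Q • dt m δ (c i • W i) = c i • Q • dt m δ (W i) + Q • p • W i := by
    simp only [Algebra.smul_def, dt_mul, hp]
    ring
  rw [h2]
  exact ((hQ i).smul _).add (((hW.isGloballyIntegral i).smul p).smul Q)

/-- The powers of a single polynomial are denominators of all the derivatives `∂_t^i f`. -/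
theorem isGloballyIntegral_smul_iterate_dt (hW : IsIntegralBasis m W) {Q : K[X]}
    (hQ : ∀ i, IsGloballyIntegral m (Q • dt m δ (W i))) {f : AlgFun m}
    (hf : IsGloballyIntegral m (Q • f)) (k : ℕ) :
    IsGloballyIntegral m (Q ^ (k + 1) • (dt m δ)^[k] f) := by
  induction k with
  | zero => simpa using hf
  | succ k ih =>
    rw [Function.iterate_succ_apply']
    set y := (dt m δ)^[k] f
    obtain ⟨p, hp⟩ := exists_dt_polynomial (m := m) δ Q
    -- By the product rule, with `p = ∂_t Q`: each application of `∂_t` costs only one more factor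
    -- `Q`.
    have h : Q ^ (k + 1 + 1) • dt m δ y =
        Q • dt m δ (Q ^ (k + 1) • y) - ((k + 1 : ℕ) * p : K[X]) • Q ^ (k + 1) • y := by
      have h1 := mul_dt_pow δ (algebraMap K[X] (AlgFun m) Q) (k + 1)
      simp only [Algebra.smul_def, dt_mul, map_pow, map_mul, map_natCast]
      rw [hp] at h1
      linear_combination (-y) * h1
    rw [h]
    exact (isGloballyIntegral_smul_dt δ hW hQ ih).sub (ih.smul _)

theorem HasDoubleRootAtInfinity.iterate_dt {f : AlgFun m} (hf : HasDoubleRootAtInfinity m f)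
    (k : ℕ) : HasDoubleRootAtInfinity m ((dt m δ)^[k] f) := by
  induction k with
  | zero => exact hf
  | succ k ih =>
    rw [Function.iterate_succ_apply']
    exact HasOrderAtLeast.dt ih

/-- There are a polynomial `Q` and Hermite reductions of all the derivatives `∂_t^i f` whose
remainders have the denominator `Q`. -/
theorem exists_common_denominator (hW : IsIntegralBasis m W) (f : AlgFun m) :
    ∃ Q : K[X], Q ≠ 0 ∧ ∀ k, ∃ g h, IsHermiteReduction m W ((dt m δ)^[k] f) g h ∧
      IsGloballyIntegral m (Q • h) := by
  obtain ⟨e, he⟩ := hW.exists_derivativeDenominator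
  obtain ⟨q₁, hq₁, hf⟩ := hW.exists_smul f
  obtain ⟨q₂, hq₂, hdt⟩ := hW.exists_common_smul fun i => dt m δ (W i)
  -- The factor `e` makes the denominator admissible for the reduction, `q₁` clears `f`, and `q₂`
  -- clears the `∂_t ω_i`.
  have hQ : e * (q₁ * q₂) ≠ 0 := mul_ne_zero (he.ne_zero hW) (mul_ne_zero hq₁ hq₂)
  refine ⟨e * (q₁ * q₂), hQ, fun k => exists_isHermiteReduction hW he hQ (dvd_mul_right _ _)
    (isGloballyIntegral_smul_iterate_dt δ hW
      (fun i => (hdt i).smul_of_dvd ⟨e * q₁, by ring⟩) (hf.smul_of_dvd ⟨e * q₂, by ring⟩) k)⟩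

end DenominatorsUnderDt

/-! ### Finite dimensionality of the span of the remainders. -/

section DegreeBound

variable {K : Type*} [Field K] [CharZero K] {m : K[X][X]} [IsDefiningPolynomial m]
  {W : Fin m.natDegree → AlgFun m}

theorem exists_common_degLE {ι : Type*} [Finite ι] (F : ι → RatFunc K) :
    ∃ N : ℕ, ∀ i, DegLE N (F i) := by
  choose n hn using fun i => exists_degLE (F i)
  obtain ⟨N, hN⟩ := (Set.finite_range n).bddAbove
  exact ⟨N.toNat, fun i => (hn i).mono ((hN ⟨i, rfl⟩).trans (Int.self_le_toNat N))⟩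

theorem dx_ratFunc_smul (r : RatFunc K) (f : AlgFun m) :
    dx m (r • f) = (differentialVar K).deriv r • f + r • dx m f := by
  rw [Algebra.smul_def, dx_mul, Algebra.smul_def, Algebra.smul_def]
  have : dx m (algebraMap (RatFunc K) (AlgFun m) r) =
      algebraMap (RatFunc K) (AlgFun m) ((differentialVar K).deriv r) :=
    differentialAdjoinRoot_algebraMap _ _ r
  rw [this]
  ring

/-- The degrees of the coefficients of `g'` are bounded, for all `g` with proper coefficients. -/
theorem exists_degree_bound_dx (hW : IsIntegralBasis m W) :
    ∃ N : ℕ, ∀ g : AlgFun m, (∀ i, DegLE (-1) (hW.coeff i g)) →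
      ∀ i, DegLE N (hW.coeff i (dx m g)) := by
  obtain ⟨N, hN⟩ := exists_common_degLE
    fun ij : Fin m.natDegree × Fin m.natDegree => hW.coeff ij.2 (dx m (W ij.1))
  refine ⟨N, fun g hg i => ?_⟩
  have h : dx m g = ∑ j, (differentialVar K).deriv (hW.coeff j g) • W j +
      ∑ j, hW.coeff j g • dx m (W j) := by
    conv_lhs => rw [← hW.sum_coeff g]
    rw [← Finset.sum_add_distrib]
    exact (map_sum (dxLinear m) _ _).trans
      (Finset.sum_congr rfl fun j _ => dx_ratFunc_smul _ _)
  rw [h, map_add, hW.coeff_sum, map_sum]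
  refine ((hg i).deriv.mono (by omega)).add (DegLE.sum fun j _ => ?_)
  rw [map_smul, smul_eq_mul]
  exact ((hg j).mul (hN (j, i))).mono (by omega)

/-- The Hermite remainders of the derivatives `∂_t^i f` span a finite dimensional space. -/
theorem AreHermiteRemainders.exists_bound (δ : Differential K) (hW : IsIntegralBasis m W)
    (hN : IsNormalAtInfinity m W) {f : AlgFun m} (hf : HasDoubleRootAtInfinity m f)
    {h : ℕ → AlgFun m} (hh : AreHermiteRemainders δ m W f h) :
    ∃ (Q : K[X]) (N : ℕ), Q ≠ 0 ∧ ∀ k, Q • h k ∈ boundedSpan W N := by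
  obtain ⟨Q, hQ, hred⟩ := exists_common_denominator δ hW f
  obtain ⟨τ, hτ⟩ := hN.exists_degree_bound hW
  obtain ⟨N₁, hN₁⟩ := exists_degree_bound_dx hW
  obtain ⟨N₂, hN₂⟩ := (Set.finite_range τ).bddAbove
  refine ⟨Q, Q.natDegree + (N₁ + N₂.toNat), hQ, fun k => ?_⟩
  obtain ⟨g, hg⟩ := hh k
  obtain ⟨g', h', hg', hQh⟩ := hred k
  -- The given reductions may start from any denominators; uniqueness transfers the denominator `Q`
  -- to their remainders.
  have huniq : h k = h' := remainder_unique hW (hg.eq.symm.trans hg'.eq) (hg.degLE_coeff hW)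
    (hg'.degLE_coeff hW) (hg.hasOrderAtLeast hW) (hg'.hasOrderAtLeast hW)
  refine hW.mem_boundedSpan (huniq ▸ hQh) fun i => ?_
  have h1 : h k = (dt m δ)^[k] f - dx m g := by rw [hg.eq, add_sub_cancel_left]
  -- This bound does not depend on `k`, because every `∂_t^k f` has a double root at infinity.
  have h2 := (hτ _).1 ((hf.iterate_dt δ k).mono (by norm_num)) i
  have h3 := hN₁ g (hg.degLE_coeff hW) i
  have h4 : τ i ≤ N₂.toNat := (hN₂ ⟨i, rfl⟩).trans (Int.self_le_toNat N₂)
  rw [← algebraMap_smul (RatFunc K) Q, map_smul, smul_eq_mul, h1, map_sub]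
  push_cast
  exact (degLE_polynomial_iff.2 (Or.inr le_rfl)).mul
    ((h2.mono (by omega)).sub (h3.mono (by omega)))

end DegreeBound

/-! ### First linear relations. -/

section Relations

variable {K : Type*} [Field K]

/-- A sequence in a vector space that has a linear relation has a first one. -/
theorem exists_first_relation {V : Type*} [AddCommGroup V] [Module K V] {h : ℕ → V}
    (hdep : ¬ LinearIndependent K h) :
    ∃ (r : ℕ) (p : ℕ →₀ K), LinearIndependent K (fun i : Fin r => h i) ∧ p ≠ 0 ∧
      (∀ i, r < i → p i = 0) ∧ (p.sum fun i c => c • h i) = 0 := by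
  classical
  have hex : ∃ (r : ℕ) (p : ℕ →₀ K), p ≠ 0 ∧ (∀ i, r < i → p i = 0) ∧
      (p.sum fun i c => c • h i) = 0 := by
    rw [linearIndependent_iff] at hdep
    push Not at hdep
    obtain ⟨p, hp, hp0⟩ := hdep
    refine ⟨p.support.sup id, p, hp0, fun i hi => ?_, hp⟩
    by_contra hne
    exact absurd (Finset.le_sup (f := id) (Finsupp.mem_support_iff.2 hne)) (not_le.2 hi)
  obtain ⟨p, hp0, hpr, hp⟩ := Nat.find_spec hex
  refine ⟨Nat.find hex, p, ?_, hp0, hpr, hp⟩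
  rw [linearIndependent_iff]
  intro l hl
  by_contra hl0
  obtain ⟨j₀, -⟩ := Finsupp.ne_iff.1 hl0
  -- A nonzero relation `l` has an index, so the minimal bound is positive; `l` is then a relation
  -- with the smaller bound `Nat.find hex - 1`, contradicting minimality.
  have hr0 : 0 < Nat.find hex := j₀.pos
  have hemb : (l.embDomain (Fin.valEmbedding)).sum (fun i c => c • h i) = 0 := by
    rw [Finsupp.sum_embDomain]
    exact hl
  refine Nat.find_min hex (m := Nat.find hex - 1) (by omega)
    ⟨l.embDomain Fin.valEmbedding, ?_, fun i hi => ?_, hemb⟩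
  · rwa [Ne, Finsupp.embDomain_eq_zero]
  · refine Finsupp.embDomain_of_notMem_range _ _ _ ?_
    rintro ⟨j, rfl⟩
    have := j.2
    simp only [Fin.valEmbedding_apply] at hi
    omega

end Relations

/-! ### Telescopers as linear relations of remainders. -/

section Telescopers

variable {K : Type*} [Field K] [CharZero K] {δ : Differential K} {m : K[X][X]}
  [IsDefiningPolynomial m] {W : Fin m.natDegree → AlgFun m} {f : AlgFun m} {h : ℕ → AlgFun m}

theorem exists_areHermiteRemainders (δ : Differential K) (hW : IsIntegralBasis m W)
    (f : AlgFun m) : ∃ h, AreHermiteRemainders δ m W f h := by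
  obtain ⟨Q, -, hred⟩ := exists_common_denominator δ hW f
  choose g h hgh using hred
  exact ⟨h, fun i => ⟨g i, (hgh i).1⟩⟩

/-- Multiplication by `Q` is injective and sends all `h k` into one finite dimensional space, so the
infinite family cannot be independent. -/
theorem AreHermiteRemainders.exists_isFirstRelation (hW : IsIntegralBasis m W)
    (hN : IsNormalAtInfinity m W) (hf : HasDoubleRootAtInfinity m f)
    (hh : AreHermiteRemainders δ m W f h) : ∃ r p, IsFirstRelation m h r p := by
  obtain ⟨Q, N, hQ, hmem⟩ := hh.exists_bound δ hW hN hf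
  refine exists_first_relation fun hind => ?_
  let T : AlgFun m →ₗ[K] AlgFun m := LinearMap.mulLeft K (algebraMap K[X] (AlgFun m) Q)
  have hT : Function.Injective T := fun x y hxy =>
    mul_left_cancel₀ (algebraMap_polynomial_ne_zero m hQ) hxy
  have h1 : LinearIndependent K (T ∘ h) := hind.map' T (LinearMap.ker_eq_bot.2 hT)
  have h2 : LinearIndependent K (fun k => (⟨Q • h k, hmem k⟩ : boundedSpan W N)) := by
    refine LinearIndependent.of_comp (boundedSpan W N).subtype ?_
    convert h1 using 1
    funext k
    exact Algebra.smul_def _ _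
  exact not_finite_iff_infinite.2 inferInstance h2.finite

/-- The operator with coefficients `q` maps `f` to an element with the Hermite remainder
`∑ q_i h_i`. -/
theorem AreHermiteRemainders.applyOperator_eq (hW : IsIntegralBasis m W)
    (hh : AreHermiteRemainders δ m W f h) (q : ℕ →₀ K) :
    ∃ g, applyOperator δ m q f = dx m g + q.sum (fun i c => c • h i) ∧
      ∀ i, DegLE (-1) (hW.coeff i g) := by
  choose g hg using hh
  refine ⟨q.sum fun i c => c • g i, ?_, fun j => ?_⟩
  · rw [applyOperator, Finsupp.sum, Finsupp.sum, Finsupp.sum]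
    have h1 : dx m (∑ i ∈ q.support, q i • g i) = ∑ i ∈ q.support, q i • dx m (g i) := by
      refine (map_sum (dxLinear m) _ _).trans (Finset.sum_congr rfl fun i _ => dx_const_smul _ _)
    rw [h1, ← Finset.sum_add_distrib]
    exact Finset.sum_congr rfl fun i _ => by rw [(hg i).eq, smul_add]
  · rw [Finsupp.sum, map_sum]
    refine DegLE.sum fun i _ => ?_
    rw [← algebraMap_smul (RatFunc K) (q i), map_smul, smul_eq_mul]
    have h2 : DegLE 0 (algebraMap K (RatFunc K) (q i)) := by
      rw [IsScalarTower.algebraMap_apply K K[X] (RatFunc K), degLE_polynomial_iff]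
      simp
    have := h2.mul ((hg i).degLE_coeff hW j)
    rwa [zero_add] at this

theorem AreHermiteRemainders.hasOrderAtLeast_sum (hW : IsIntegralBasis m W)
    (hh : AreHermiteRemainders δ m W f h) (q : ℕ →₀ K) (a : AlgebraicClosure K) :
    HasOrderAtLeast m (OnePoint.some a) (-1) (q.sum fun i c => c • h i) := by
  refine HasOrderAtLeast.sum fun i _ => ?_
  obtain ⟨g, hg⟩ := hh i
  exact (hg.hasOrderAtLeast hW a).const_smul _

/-- The coefficients of a telescoper are those of a linear relation of the Hermite remainders. -/
theorem IsTelescoper.sum_remainders_eq_zero (hW : IsIntegralBasis m W)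
    (hN : IsNormalAtInfinity m W) (hf : HasDoubleRootAtInfinity m f)
    (hh : AreHermiteRemainders δ m W f h) {q : ℕ →₀ K} (hq : IsTelescoper δ m q f) :
    (q.sum fun i c => c • h i) = 0 := by
  obtain ⟨-, F, hF⟩ := hq
  obtain ⟨g, hg, hdeg⟩ := hh.applyOperator_eq hW q
  refine remainder_eq_zero hW hN (F := F) (g := g) ?_ (hF.trans hg) hdeg
    (hh.hasOrderAtLeast_sum hW q)
  -- The criterion needs a double root of `P · f`, which follows since `∂_t` and combinations over
  -- `K` preserve it.
  rw [hF]
  exact HasOrderAtLeast.sum fun i _ => (hf.iterate_dt δ i).const_smul _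

theorem eq_zero_of_lt_of_linearIndependent {V : Type*} [AddCommGroup V] [Module K V] {v : ℕ → V}
    {r : ℕ} (hind : LinearIndependent K (fun i : Fin r => v i)) {q : ℕ →₀ K}
    (hq : ∀ i, r ≤ i → q i = 0) (hsum : (q.sum fun i c => c • v i) = 0) : q = 0 := by
  have h1 : ∑ i : Fin r, q i • v i = 0 := by
    rw [Fin.sum_univ_eq_sum_range (fun i => q i • v i), ← hsum]
    refine (Finsupp.sum_of_support_subset q (fun i hi => ?_) (fun i c => c • v i)
      fun i _ => zero_smul K (v i)).symm
    rw [Finset.mem_range]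
    by_contra hle
    exact Finsupp.mem_support_iff.1 hi (hq i (not_lt.1 hle))
  ext i
  by_cases hi : i < r
  · exact Fintype.linearIndependent_iff.1 hind (fun i => q i) h1 ⟨i, hi⟩
  · exact hq i (not_lt.1 hi)

theorem IsFirstRelation.isTelescoper (hW : IsIntegralBasis m W)
    (hh : AreHermiteRemainders δ m W f h) {r : ℕ} {p : ℕ →₀ K} (hp : IsFirstRelation m h r p) :
    IsTelescoper δ m p f := by
  obtain ⟨g, hg, -⟩ := hh.applyOperator_eq hW p
  exact ⟨hp.2.1, g, by rw [hg, hp.2.2.2, add_zero]⟩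

theorem le_operatorOrder {p : ℕ →₀ K} {i : ℕ} (hi : p i ≠ 0) : i ≤ operatorOrder p :=
  Finset.le_sup (f := id) (Finsupp.mem_support_iff.2 hi)

/-- If `p r` were zero, `p` would be a relation among the independent `h 0, …, h (r - 1)` and hence
zero. -/
theorem IsFirstRelation.operatorOrder_eq {r : ℕ} {p : ℕ →₀ K} (hp : IsFirstRelation m h r p) :
    operatorOrder p = r := by
  obtain ⟨hind, hp0, hpr, hsum⟩ := hp
  refine le_antisymm (Finset.sup_le fun i hi => ?_) (le_operatorOrder fun h0 => hp0 ?_)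
  · by_contra hlt
    exact Finsupp.mem_support_iff.1 hi (hpr i (not_le.1 hlt))
  · refine eq_zero_of_lt_of_linearIndependent hind (fun i hi => ?_) hsum
    rcases hi.eq_or_lt with rfl | hi
    · exact h0
    · exact hpr i hi

/-- A telescoper of smaller order would give a nontrivial relation among the independent remainders.
-/
theorem IsFirstRelation.le_operatorOrder (hW : IsIntegralBasis m W) (hN : IsNormalAtInfinity m W)
    (hf : HasDoubleRootAtInfinity m f) (hh : AreHermiteRemainders δ m W f h) {r : ℕ} {p : ℕ →₀ K}
    (hp : IsFirstRelation m h r p) {q : ℕ →₀ K} (hq : IsTelescoper δ m q f) :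
    r ≤ operatorOrder q := by
  by_contra hlt
  refine hq.1 (eq_zero_of_lt_of_linearIndependent hp.1 (fun i hi => ?_)
    (hq.sum_remainders_eq_zero hW hN hf hh))
  by_contra h0
  have := AlgTelescoping.le_operatorOrder h0
  omega

end Telescopers

end AlgTelescoping

end

/-! ### The case `K = C(t)` with `d/dt`; the preceding results hold for any derivation of a field of
characteristic zero. -/

open AlgTelescoping Polynomial
theorem mainTheorem1 {C : Type*} [Field C] [CharZero C] (m : (RatFunc C)[X][X])
    [IsDefiningPolynomial m] (W : Fin m.natDegree → AlgFun m)
    (hW : IsIntegralBasis m W) (hW_infty : IsNormalAtInfinity m W)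
    (f : AlgFun m) (hf : HasDoubleRootAtInfinity m f) :
    (∀ g h : AlgFun m, IsHermiteReduction m W f g h → (h = 0 ↔ IsIntegrable m f)) ∧
    (∃ h : ℕ → AlgFun m, AreHermiteRemainders (differentialVar C) m W f h) ∧
    (∀ h : ℕ → AlgFun m, AreHermiteRemainders (differentialVar C) m W f h →
      (∃ (r : ℕ) (p : ℕ →₀ RatFunc C), IsFirstRelation m h r p) ∧
      ∀ (r : ℕ) (p : ℕ →₀ RatFunc C), IsFirstRelation m h r p →
        IsTelescoper (differentialVar C) m p f ∧ operatorOrder p = r ∧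
        ∀ q : ℕ →₀ RatFunc C, IsTelescoper (differentialVar C) m q f → r ≤ operatorOrder q) :=
  ⟨fun _ _ hr => hr.eq_zero_iff hW hW_infty hf, exists_areHermiteRemainders _ hW f,
    fun _ hh => ⟨hh.exists_isFirstRelation hW hW_infty hf, fun _ _ hp =>
      ⟨hp.isTelescoper hW hh, hp.operatorOrder_eq, fun _ hq =>
        hp.le_operatorOrder hW hW_infty hf hh hq⟩⟩⟩
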